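/- **Setting.** For $n\ge 1$ let $(\mathcal X_n,K_n,\pi_n)$ be an irreducible Markov chain: $\mathcal X_n$ is a countable set, $K_n$ is an irreducible stochastic matrix indexed by $\mathcal X_n$, and $\pi_n$ is a stationary probability of $K_n$. Write $\mathcal F=(\mathcal X_n,K_n,\pi_n)_{n\ge1}$. For any such chain $(\mathcal X,K,\pi)$ the associated continuous time chain has transition matrices $H_t=e^{-t(I-K)}=\sum_{m\ge0}e^{-t}\frac{t^m}{m!}K^m$, $t\ge 0$, and its maximum total variation and Hellinger distances are $$d^{(c)}_{\rm TV}(t)=\sup_{x\in\mathcal X,\,S\subset\mathcal X}\{H_t(x,S)-\pi(S)\},\qquad d^{(c)}_{H}(t)=\sup_{x\in\mathcal X}\Big(\tfrac12\sum_{y\in\mathcal X}\big(\sqrt{H_t(x,y)}-\sqrt{\pi(y)}\big)^2\Big)^{1/2},$$ with mixing times $T^{(c)}_*(\epsilon)=\inf\{t\ge0: d^{(c)}_*(t)\le\epsilon\}\in[0,\infty]$ for $*\in\{{\rm TV},H\}$. A family of continuous time chains with distances $d^{(c)}_{n,*}$ has a cutoff in $*$ with cutoff time $(t_n)$ if $t_n>0$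 for all $n$, $\lim_n d^{(c)}_{n,*}(at_n)=0$ for all $a>1$, and $\lim_n d^{(c)}_{n,*}(at_n)=1$ for all $a\in(0,1)$; it has a cutoff if such a sequence $(t_n)$ exists. Let $(p_n)_{n\ge1}$ be positive reals and $q_n=p_1+\cdots+p_n$. Let $\mathcal F^{\mathcal P}$ be the family whose $n$th chain is the product of the first $n$ chains according to $(p_1/q_n,\dots,p_n/q_n)$, i.e. the chain on $\mathcal X_1\times\cdots\times\mathcal X_n$ with transition matrix $\sum_{i=1}^n\frac{p_i}{q_n}\,I\otimes\cdots\otimes I\otimes K_i\otimes I\otimes\cdots\otimes I$ ($K_i$ in the $i$th place) and stationary distribution $\pi_1\times\cdots\times\pi_n$. Let $\mathcal F_c$ and $\mathcal F^{\mathcal P}_c$ be the families of continuous time chains associated with $\mathcal F$ and $\mathcal F^{\mathcal P}$. A subfamily of $\mathcal F_c$ is the family of its chains with indices $\xi_1<\xi_2<\cdots$, for a strictly increasing sequence $(\xi_n)$ of positive integers. **Theorem.** Let $(\epsilon_n)$ satisfy $0<\inf_n\epsilon_n\le\sup_n\epsilon_n<1/2$, let $T^{(c)}_{n,{\rm TV}}$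 be the total variation mixing time of the $n$th chain of $\mathcal F_c$, and suppose that for all $n\ge1$ $$D_n:=\log\frac{T^{(c)}_{n,{\rm TV}}(\epsilon_n)}{p_n}=A_nn+B_n+C_n$$ with real numbers $A_n,B_n,C_n$ (in particular $0<T^{(c)}_{n,{\rm TV}}(\epsilon_n)<\infty$). Assume that (I) either $0<A_n\le A_{n+1}$ for all $n$, or there is $A>0$ such that $n|A_n-A|$ is bounded; (II) $B_n$ is nondecreasing, $C_n$ is bounded, and $D_n$ is nondecreasing for $n$ large enough. Then, in the total variation: (1) if $\mathcal F_c$ has a cutoff with cutoff time $t_n$, then $\mathcal F^{\mathcal P}_c$ has a cutoff with cutoff time $(p_1+\cdots+p_n)t_n/p_n$; (2) if no subfamily of $\mathcal F_c$ has a cutoff, then $\mathcal F^{\mathcal P}_c$ has no cutoff. The same conclusions hold in the Hellinger distance if $\sup_n\epsilon_n<1/4$ and $T^{(c)}_{n,{\rm TV}}$ is replaced by $T^{(c)}_{n,H}$, the mixing time of the $n$th chain of $\mathcal F_c$ in the Hellinger distance. -/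

import Mathlib

open Filter Topology
open scoped ENNReal BigOperators

namespace ProductChain

universe u v

noncomputable section

/-- The identity matrix indexed by an arbitrary set. -/
def idMat {X : Type u} (x y : X) : ℝ :=
  open Classical in if x = y then 1 else 0

/-- The `m`-step transition probabilities `K^m(x,y)` of a transition matrix `K`. -/
def stepPow {X : Type u} (K : X → X → ℝ) : ℕ → X → X → ℝ
  | 0 => idMat
  | m + 1 => fun x y => ∑' z, K x z * stepPow K m z y

/-- `(X, K, π)` is an irreducible Markov chain: `K` is an irreducible stochastic matrix indexed
by `X`, and `π` is a probability on `X` that is stationary for `K`. -/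
structure IsIrreducibleChain {X : Type u} (K : X → X → ℝ) (π : X → ℝ) : Prop where
  nonneg : ∀ x y, 0 ≤ K x y
  row_sum : ∀ x, HasSum (K x) 1
  irreducible : ∀ x y, ∃ m : ℕ, 0 < stepPow K m x y
  prob_nonneg : ∀ x, 0 ≤ π x
  prob_sum : HasSum π 1
  stationary : ∀ y, HasSum (fun x => π x * K x y) (π y)

/-- The transition matrix `H_t = e^{-t(I-K)} = ∑ₘ e^{-t} (t^m / m!) K^m` at time `t ≥ 0` of the
continuous time chain associated with `K`. -/
def heat {X : Type u} (K : X → X → ℝ) (t : ℝ) (x y : X) : ℝ :=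
  ∑' m : ℕ, Real.exp (-t) * (t ^ m / (m.factorial : ℝ)) * stepPow K m x y

/-- The maximum total variation of the continuous time chain,
`sup {H_t(x, S) - π(S) : x ∈ X, S ⊆ X}`. -/
def dTV {X : Type u} (K : X → X → ℝ) (π : X → ℝ) (t : ℝ) : ℝ :=
  ⨆ q : X × Set X, ((∑' y : q.2, heat K t q.1 y) - ∑' y : q.2, π y)

/-- The maximum Hellinger distance of the continuous time chain. -/
def dH {X : Type u} (K : X → X → ℝ) (π : X → ℝ) (t : ℝ) : ℝ :=
  ⨆ x : X, Real.sqrt (1 / 2 * ∑' y, (Real.sqrt (heat K t x y) - Real.sqrt (π y)) ^ 2)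

/-- The mixing time `inf {t ≥ 0 : d(t) ≤ ε}`, with `inf ∅ = ∞`. -/
def mixingTime (d : ℝ → ℝ) (ε : ℝ) : ℝ≥0∞ :=
  ⨅ (t : ℝ) (_ : 0 ≤ t ∧ d t ≤ ε), ENNReal.ofReal t

/-- A family of chains with distances `d n` has a cutoff with cutoff time `t n`. -/
def IsCutoffTime (d : ℕ → ℝ → ℝ) (t : ℕ → ℝ) : Prop :=
  (∀ n, 0 < t n) ∧
  (∀ a : ℝ, 1 < a → Tendsto (fun n => d n (a * t n)) atTop (𝓝 0)) ∧
  (∀ a : ℝ, 0 < a → a < 1 → Tendsto (fun n => d n (a * t n)) atTop (𝓝 1))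

/-- A family of chains with distances `d n` has a cutoff. -/
def HasCutoff (d : ℕ → ℝ → ℝ) : Prop :=
  ∃ t : ℕ → ℝ, IsCutoffTime d t

/-- The matrix `∑ᵢ wᵢ I ⊗ ⋯ ⊗ I ⊗ Kᵢ ⊗ I ⊗ ⋯ ⊗ I` on the product of the state spaces. -/
def prodMat {ι : Type v} [Fintype ι] [DecidableEq ι] {Y : ι → Type u} (w : ι → ℝ)
    (K : ∀ i, Y i → Y i → ℝ) (x y : ∀ i, Y i) : ℝ :=
  ∑ i, w i * (K i (x i) (y i) * ∏ j ∈ Finset.univ.erase i, idMat (x j) (y j))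

/-- `q_n`, the sum of the weights of the first chains up to index `n`. -/
def weightSum (p : ℕ → ℝ) (n : ℕ) : ℝ :=
  ∑ i ∈ Finset.range (n + 1), p i

/-- The transition matrix of the product of the chains with indices `0, …, n` according to the
probability vector `(p 0 / q_n, …, p n / q_n)`. -/
def productK {X : ℕ → Type u} (K : ∀ n, X n → X n → ℝ) (p : ℕ → ℝ) (n : ℕ) :
    (∀ i : Fin (n + 1), X i) → (∀ i : Fin (n + 1), X i) → ℝ :=
  prodMat (fun i : Fin (n + 1) => p i / weightSum p n) (fun i : Fin (n + 1) => K i)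

/-- The product of the stationary distributions of the chains with indices `0, …, n`. -/
def productPi {X : ℕ → Type u} (π : ∀ n, X n → ℝ) (n : ℕ) (x : ∀ i : Fin (n + 1), X i) : ℝ :=
  ∏ i : Fin (n + 1), π i (x i)

end

end ProductChain

namespace ProductChain

universe u v

noncomputable section

set_option linter.unusedSectionVars false

/-! At time `q n * t` the coordinates of the `n`th product are independent, and the `i`th one has
run for time `p i * t`. Both distances come from an affinity `∑ φ (H_t(x, y)) (π y)`: with `φ` the
minimum, the supremum of one minus the affinity is the total variation; with `φ` the geometric mean
it is the squared Hellinger distance. The affinity of two product distributions is at least the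
product of the affinities of the factors and at most each of them. With `d i` and `P n` the
resulting distances of the chains and of the products, this gives `d i (p i * t) ≤ P n (q n * t)`
and `∏ (1 - d i (p i * t)) ≤ 1 - P n (q n * t)`. Everything about cutoffs follows from these two
inequalities and from two estimates on `E n = exp (D n)`, where `p n * E n` is the mixing time.

The hypotheses on `D` make `E` grow geometrically, `E i ≤ M * exp (-c) ^ (n - i) * E n`, and
submultiplicativity of twice the total variation gives `d n t ≤ C * (p n * E n / t)`. So at a time
`s` of order `E n` the chains with index at most `n - k` contribute to `∑ d i (p i * s)` no more
than a constant times `ρ ^ k` (`tail_le`): only the last `k` chains matter.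

If the chains have a cutoff at `t n`, then `t n` is asymptotic to `p n * E n`. Before the proposed
time the product is unmixed because its last factor is. After it, each of the last `k` factors is
mixed, since `E` is eventually nondecreasing, and the union bound concludes.

Conversely, let the products have a cutoff. Just before it `∏ (1 - d i)` tends to `0`, while the old
chains keep their part of the product above `1/2`; hence one of the last `k` chains is almost
unmixed. Just after it every factor is mixed. A diagonal choice of such chains is a subfamily with a
cutoff. -/

/-! ### Elementary sums and products -/

theorem prod_one_sub_ge {ι : Type*} (s : Finset ι) (f : ι → ℝ) (h0 : ∀ i ∈ s, 0 ≤ f i)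
    (h1 : ∀ i ∈ s, f i ≤ 1) : 1 - ∑ i ∈ s, f i ≤ ∏ i ∈ s, (1 - f i) := by
  classical
  induction s using Finset.induction_on with
  | empty => simp
  | insert a s ha ih =>
    rw [Finset.sum_insert ha, Finset.prod_insert ha]
    have ih' := ih (fun i hi => h0 i (Finset.mem_insert_of_mem hi))
      (fun i hi => h1 i (Finset.mem_insert_of_mem hi))
    have ha0 := h0 a (Finset.mem_insert_self a s)
    have ha1 := h1 a (Finset.mem_insert_self a s)
    have hs : 0 ≤ ∑ i ∈ s, f i :=
      Finset.sum_nonneg fun i hi => h0 i (Finset.mem_insert_of_mem hi)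
    have := mul_le_mul_of_nonneg_left ih' (sub_nonneg.2 ha1)
    nlinarith [mul_nonneg ha0 hs]

/-- A sum over `0, …, n` is split into the terms with index at most `n - k` and the last `k`
terms. -/
theorem sum_range_succ_split (f : ℕ → ℝ) {n k : ℕ} (hk : k ≤ n) :
    ∑ i ∈ Finset.range (n + 1), f i
      = ∑ i ∈ Finset.range (n + 1 - k), f i + ∑ j ∈ Finset.range k, f (n - j) := by
  induction k with
  | zero => simp
  | succ k ih =>
    rw [ih (by omega), Finset.sum_range_succ _ k]
    have : n + 1 - k = (n + 1 - (k + 1)) + 1 := by omega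
    rw [this, Finset.sum_range_succ]
    have : n + 1 - (k + 1) = n - k := by omega
    rw [this]; ring

theorem prod_range_succ_split (f : ℕ → ℝ) {n k : ℕ} (hk : k ≤ n) :
    ∏ i ∈ Finset.range (n + 1), f i
      = (∏ i ∈ Finset.range (n + 1 - k), f i) * ∏ j ∈ Finset.range k, f (n - j) := by
  induction k with
  | zero => simp
  | succ k ih =>
    rw [ih (by omega), Finset.prod_range_succ _ k]
    have : n + 1 - k = (n + 1 - (k + 1)) + 1 := by omega
    rw [this, Finset.prod_range_succ]
    have : n + 1 - (k + 1) = n - k := by omega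
    rw [this]; ring

theorem sum_geometric_reflect_le {ρ : ℝ} (h0 : 0 ≤ ρ) (h1 : ρ < 1) (n k : ℕ) :
    ∑ i ∈ Finset.range (n + 1 - k), ρ ^ (n - i) ≤ ρ ^ k * (1 - ρ)⁻¹ := by
  have h : ∑ i ∈ Finset.range (n + 1 - k), ρ ^ (n - i)
      = ∑ j ∈ Finset.range (n + 1 - k), ρ ^ (k + j) := by
    rw [← Finset.sum_range_reflect]
    refine Finset.sum_congr rfl fun j hj => ?_
    have := Finset.mem_range.1 hj
    congr 1
    omega
  rw [h]
  simp_rw [pow_add]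
  rw [← Finset.mul_sum]
  refine mul_le_mul_of_nonneg_left ?_ (pow_nonneg h0 k)
  rw [← tsum_geometric_of_lt_one h0 h1]
  exact (summable_geometric_of_lt_one h0 h1).sum_le_tsum _ fun i _ => pow_nonneg h0 i

/-! ### Comparison of cutoffs in an abstract setting -/

/-- The properties of the distances `d n` of a sequence of chains and of the distances `P n` of
their products that enter the comparison of cutoffs. The time scale of the `n`th chain is
`p n * E n`. -/
structure ProductFamily (d P : ℕ → ℝ → ℝ) (p q E : ℕ → ℝ) : Prop where
  p_pos : ∀ n, 0 < p n
  q_pos : ∀ n, 0 < q n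
  E_pos : ∀ n, 0 < E n
  nonneg : ∀ n t, 0 ≤ t → 0 ≤ d n t
  le_one : ∀ n t, 0 ≤ t → d n t ≤ 1
  anti : ∀ n s t, 0 ≤ s → s ≤ t → d n t ≤ d n s
  prod_le_one : ∀ n t, 0 ≤ t → P n t ≤ 1
  le_prod : ∀ n i t, 0 ≤ t → i ≤ n → d i (p i * t) ≤ P n (q n * t)
  prod_upper : ∀ n t, 0 ≤ t →
    ∏ i ∈ Finset.range (n + 1), (1 - d i (p i * t)) ≤ 1 - P n (q n * t)
  decay : ∃ C : ℝ, 0 < C ∧ ∀ n t, 0 < t → d n t ≤ C * (p n * E n / t)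
  growth : ∃ c M : ℝ, 0 < c ∧ 0 < M ∧ ∀ i n : ℕ, i ≤ n →
    E i ≤ M * Real.exp (-c) ^ (n - i) * E n
  threshold_le : ∃ a : ℝ, 0 < a ∧ ∀ n t, 0 ≤ t → t < p n * E n → a ≤ d n t
  le_threshold : ∃ b : ℝ, b < 1 ∧ ∀ n t, p n * E n < t → d n t ≤ b

namespace ProductFamily

variable {d P : ℕ → ℝ → ℝ} {p q E : ℕ → ℝ}

/-- At time `p i * s` the decay bound is `C * (E i / s)`, free of the weights; the growth of `E`
then leaves a geometric series. -/
theorem tail_le (h : ProductFamily d P p q E) : ∃ G ρ : ℝ, 0 < G ∧ 0 < ρ ∧ ρ < 1 ∧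
    ∀ (n k : ℕ) (s : ℝ), 0 < s →
      ∑ i ∈ Finset.range (n + 1 - k), d i (p i * s) ≤ G * (E n / s) * ρ ^ k := by
  obtain ⟨C, hC, hdec⟩ := h.decay
  obtain ⟨c, M, hc, hM, hgr⟩ := h.growth
  have hρ1 : Real.exp (-c) < 1 := by
    rw [Real.exp_lt_one_iff]; linarith
  refine ⟨C * M * (1 - Real.exp (-c))⁻¹, Real.exp (-c), ?_, Real.exp_pos _, hρ1, ?_⟩
  · have : 0 < 1 - Real.exp (-c) := by linarith
    positivity
  · intro n k s hs
    calc ∑ i ∈ Finset.range (n + 1 - k), d i (p i * s)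
        ≤ ∑ i ∈ Finset.range (n + 1 - k), C * M * (E n / s) * Real.exp (-c) ^ (n - i) := by
          refine Finset.sum_le_sum fun i hi => ?_
          have hi' : i ≤ n := by
            have := Finset.mem_range.1 hi
            omega
          have hp := h.p_pos i
          have h1 := hdec i (p i * s) (by positivity)
          have h2 : p i * E i / (p i * s) = E i / s := by field_simp
          rw [h2] at h1
          refine h1.trans ?_
          have h3 := div_le_div_of_nonneg_right (hgr i n hi') hs.le
          have h4 := mul_le_mul_of_nonneg_left h3 hC.le
          refine h4.trans (le_of_eq ?_)
          ring
      _ = C * M * (E n / s) * ∑ i ∈ Finset.range (n + 1 - k), Real.exp (-c) ^ (n - i) := by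
          rw [Finset.mul_sum]
      _ ≤ C * M * (E n / s) * (Real.exp (-c) ^ k * (1 - Real.exp (-c))⁻¹) := by
          refine mul_le_mul_of_nonneg_left
            (sum_geometric_reflect_le (Real.exp_pos _).le hρ1 n k) ?_
          have := h.E_pos n
          positivity
      _ = _ := by ring

theorem prod_le_sum (h : ProductFamily d P p q E) (n : ℕ) {t : ℝ} (ht : 0 ≤ t) :
    P n (q n * t) ≤ ∑ i ∈ Finset.range (n + 1), d i (p i * t) := by
  have h1 := h.prod_upper n t ht
  have h2 := prod_one_sub_ge (Finset.range (n + 1)) (fun i => d i (p i * t))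
    (fun i _ => h.nonneg i _ (mul_nonneg (h.p_pos i).le ht))
    (fun i _ => h.le_one i _ (mul_nonneg (h.p_pos i).le ht))
  linarith

/-- A cutoff time exceeds, up to a factor close to `1`, the time scale of the chains. -/
theorem eventually_scale_le (h : ProductFamily d P p q E) {t : ℕ → ℝ} (ht : ∀ n, 0 < t n)
    {a : ℝ} (ha : 0 < a) (hlim : Tendsto (fun n => d n (a * t n)) atTop (𝓝 0)) :
    ∀ᶠ n in atTop, p n * E n ≤ a * t n := by
  obtain ⟨e, he, hthr⟩ := h.threshold_le
  filter_upwards [hlim.eventually_lt_const he] with n hn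
  by_contra hcon
  have := hthr n (a * t n) (mul_pos ha (ht n)).le (not_le.1 hcon)
  linarith

theorem eventually_le_scale (h : ProductFamily d P p q E) {t : ℕ → ℝ}
    {a : ℝ} (hlim : Tendsto (fun n => d n (a * t n)) atTop (𝓝 1)) :
    ∀ᶠ n in atTop, a * t n ≤ p n * E n := by
  obtain ⟨e, he, hthr⟩ := h.le_threshold
  filter_upwards [hlim.eventually_const_lt he] with n hn
  by_contra hcon
  have := hthr n (a * t n) (not_le.1 hcon)
  linarith

theorem tendsto_prod_zero (h : ProductFamily d P p q E)
    (hmono : ∃ N : ℕ, ∀ n, N ≤ n → E n ≤ E (n + 1)) {t : ℕ → ℝ} (ht : IsCutoffTime d t)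
    {a : ℝ} (ha : 1 < a) :
    Tendsto (fun n => P n (a * (q n * t n / p n))) atTop (𝓝 0) := by
  obtain ⟨tpos, hup, hlow⟩ := ht
  obtain ⟨N, hN⟩ := hmono
  obtain ⟨G, ρ, hG, hρ0, hρ1, htail⟩ := h.tail_le
  have a0 : 0 < a := by linarith
  have mono : ∀ j n, N + j ≤ n → E (n - j) ≤ E n := by
    intro j n hj
    induction j with
    | zero => simp
    | succ j ih =>
      have h1 := hN (n - (j + 1)) (by omega)
      have h2 : n - (j + 1) + 1 = n - j := by omega
      rw [h2] at h1
      exact h1.trans (ih (by omega))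
  have spos : ∀ n, 0 < a * t n / p n := fun n => div_pos (mul_pos a0 (tpos n)) (h.p_pos n)
  -- the last terms
  have last : ∀ j, Tendsto (fun n => d (n - j) (p (n - j) * (a * t n / p n))) atTop (𝓝 0) := by
    intro j
    -- With `1 < r' < r < a`, the cutoff time is comparable with the scale at both indices: `r' * t
    -- (n - j) ≤ r * p (n - j) * E (n - j) ≤ r * p (n - j) * E n ≤ p (n - j) * (a * t n / p n)`. The
    -- chain `n - j` is thus observed after `r'` times its own cutoff time.
    obtain ⟨r, hr1, hra⟩ := exists_between ha
    obtain ⟨r', hr'1, hr'r⟩ := exists_between hr1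
    have hr0 : 0 < r := by linarith
    have hr'0 : 0 < r' := by linarith
    have ev1 := h.eventually_scale_le tpos (a := a / r) (by positivity)
      (hup _ (by rw [lt_div_iff₀ hr0]; linarith))
    have ev2 := (tendsto_sub_atTop_nat j).eventually
      (h.eventually_le_scale (hlow (r' / r) (by positivity) (by rw [div_lt_one hr0]; exact hr'r)))
    have lim := (hup r' hr'1).comp (tendsto_sub_atTop_nat j)
    refine squeeze_zero' (Eventually.of_forall fun n => ?_) ?_ lim
    · exact h.nonneg _ _ (mul_pos (h.p_pos _) (spos n)).le
    · filter_upwards [ev1, ev2, eventually_ge_atTop (N + j)] with n h1 h2 h3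
      refine h.anti _ _ _ (mul_pos hr'0 (tpos _)).le ?_
      have pn := h.p_pos n
      have pj := h.p_pos (n - j)
      have e1 : E n ≤ (a / r) * t n / p n := by
        rw [le_div_iff₀ pn]; linarith
      have e2 := mono j n h3
      have e3 : p (n - j) * E (n - j) ≤ p (n - j) * ((a / r) * t n / p n) :=
        mul_le_mul_of_nonneg_left (e2.trans e1) pj.le
      have e4 := mul_le_mul_of_nonneg_left (h2.trans e3) hr0.le
      have e5 : r * (r' / r * t (n - j)) = r' * t (n - j) := by field_simp
      have e6 : r * (p (n - j) * ((a / r) * t n / p n)) = p (n - j) * (a * t n / p n) := by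
        field_simp
      rw [e5, e6] at e4
      exact e4
  have ev := h.eventually_scale_le tpos a0 (hup a ha)
  have key : ∀ n, a * (q n * t n / p n) = q n * (a * t n / p n) := fun n => by ring
  simp_rw [key]
  rw [Metric.tendsto_atTop']
  intro η hη
  -- `k` is fixed before `n` grows: the tail costs at most `η / 2` uniformly, and the remaining `k`
  -- terms tend to `0` one by one.
  obtain ⟨k, hk⟩ : ∃ k : ℕ, ρ ^ k < η / 2 / G :=
    exists_pow_lt_of_lt_one (by positivity) hρ1
  have hk' : G * ρ ^ k < η / 2 := by
    rw [lt_div_iff₀ hG] at hk; linarith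
  have lims : Tendsto (fun n => ∑ j ∈ Finset.range k,
      d (n - j) (p (n - j) * (a * t n / p n))) atTop (𝓝 0) := by
    simpa using tendsto_finsetSum (Finset.range k) fun j _ => last j
  have evs := lims.eventually_lt_const (half_pos hη)
  obtain ⟨n₀, hn₀⟩ := eventually_atTop.1 ((ev.and evs).and (eventually_ge_atTop k))
  refine ⟨n₀, fun n hn => ?_⟩
  obtain ⟨⟨h1, h2⟩, h3⟩ := hn₀ n hn.le
  have hpos : 0 ≤ P n (q n * (a * t n / p n)) :=
    (h.nonneg n _ (mul_pos (h.p_pos n) (spos n)).le).trans (h.le_prod n n _ (spos n).le le_rfl)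
  rw [Real.dist_eq, sub_zero, abs_of_nonneg hpos]
  have h4 := h.prod_le_sum n (spos n).le
  rw [sum_range_succ_split _ h3] at h4
  have h5 := htail n k _ (spos n)
  have h6 : E n / (a * t n / p n) ≤ 1 := by
    rw [div_le_one (spos n), le_div_iff₀ (h.p_pos n)]; linarith
  have h7 : G * (E n / (a * t n / p n)) * ρ ^ k ≤ G * ρ ^ k := by
    have := mul_le_mul_of_nonneg_left h6 (mul_nonneg hG.le (pow_nonneg hρ0.le k))
    linarith
  linarith

/-- A cutoff of the chains implies a cutoff of the products. -/
theorem isCutoffTime_prod (h : ProductFamily d P p q E)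
    (hmono : ∃ N : ℕ, ∀ n, N ≤ n → E n ≤ E (n + 1)) {t : ℕ → ℝ} (ht : IsCutoffTime d t) :
    IsCutoffTime P (fun n => q n * t n / p n) := by
  refine ⟨fun n => div_pos (mul_pos (h.q_pos n) (ht.1 n)) (h.p_pos n),
    fun a ha => h.tendsto_prod_zero hmono ht ha, fun a ha0 ha1 => ?_⟩
  have key : ∀ n, a * (q n * t n / p n) = q n * (a * t n / p n) := fun n => by ring
  have spos : ∀ n, 0 ≤ a * t n / p n := fun n =>
    (div_pos (mul_pos ha0 (ht.1 n)) (h.p_pos n)).le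
  refine tendsto_of_tendsto_of_tendsto_of_le_of_le (ht.2.2 a ha0 ha1) tendsto_const_nhds
    (fun n => ?_) (fun n => ?_)
  · have h1 := h.le_prod n n _ (spos n) le_rfl
    have h2 : p n * (a * t n / p n) = a * t n := by
      have := h.p_pos n
      field_simp
    rw [h2] at h1
    simpa only [key] using h1
  · simp only [key]
    exact h.prod_le_one n _ (mul_nonneg (h.q_pos n).le (spos n))

/-- A cutoff of the products implies a cutoff of some subfamily of the chains. -/
theorem exists_subfamily_cutoff (h : ProductFamily d P p q E) (hP : HasCutoff P) :
    ∃ ξ : ℕ → ℕ, StrictMono ξ ∧ HasCutoff (fun n => d (ξ n)) := by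
  obtain ⟨s, spos, hup, hlow⟩ := hP
  obtain ⟨G, ρ, hG, hρ0, hρ1, htail⟩ := h.tail_le
  set τ : ℕ → ℝ := fun n => s n / q n with hτ
  have τpos : ∀ n, 0 < τ n := fun n => div_pos (spos n) (h.q_pos n)
  have key : ∀ a n, a * s n = q n * (a * τ n) := fun a n => by
    have := h.q_pos n
    simp only [hτ]; field_simp
  simp_rw [key] at hup hlow
  -- At twice its cutoff time the product is mixed, hence so is its `n`th factor, whose scale must
  -- have passed.
  have ev : ∀ᶠ n in atTop, E n ≤ 2 * τ n := by
    have lim : Tendsto (fun n => d n (2 * (p n * τ n))) atTop (𝓝 0) := by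
      refine squeeze_zero (fun n => h.nonneg _ _ ?_) (fun n => ?_) (hup 2 one_lt_two)
      · have := h.p_pos n
        have := τpos n
        positivity
      · have := h.le_prod n n (2 * τ n) (by have := τpos n; positivity) le_rfl
        rwa [show p n * (2 * τ n) = 2 * (p n * τ n) by ring] at this
    filter_upwards [h.eventually_scale_le (fun n => mul_pos (h.p_pos n) (τpos n)) two_pos lim]
      with n hn
    have pn := h.p_pos n
    have : p n * E n ≤ p n * (2 * τ n) := by linarith
    exact le_of_mul_le_mul_left this pn
  -- At `r = (1 - δ j) * τ n ≥ τ n / 2` one has `E n / r ≤ 4`, so the tail sum stays below `1/2`.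
  -- The same `k` serves all `j`.
  obtain ⟨k, hk⟩ : ∃ k : ℕ, ρ ^ k < 1 / (8 * G) :=
    exists_pow_lt_of_lt_one (by positivity) hρ1
  have hk' : 4 * G * ρ ^ k < 1 / 2 := by
    rw [lt_div_iff₀ (by positivity)] at hk; linarith
  set δ : ℕ → ℝ := fun j => 1 / ((j : ℝ) + 2) with hδ
  have δpos : ∀ j, 0 < δ j := fun j => by simp only [hδ]; positivity
  have δhalf : ∀ j, δ j ≤ 1 / 2 := fun j => by
    simp only [hδ]
    exact one_div_le_one_div_of_le two_pos (by linarith [(Nat.cast_nonneg j : (0 : ℝ) ≤ j)])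
  have freq : ∀ j, ∃ᶠ i in atTop, ∃ n, i ≤ n ∧ 1 - δ j ≤ d i (p i * ((1 - δ j) * τ n)) := by
    intro j
    have aj : 1 / 2 ≤ 1 - δ j := by linarith [δhalf j]
    have dk : 0 < δ j ^ k := pow_pos (δpos j) k
    -- If all of the last `k` factors had `1 - d > δ j`, the whole product would be at least `1/2 *
    -- δ j ^ k`; the threshold for `P` excludes this.
    have ev1 := (hlow (1 - δ j) (by linarith) (by linarith [δpos j])).eventually_const_lt
      (show 1 - δ j ^ k / 2 < 1 by linarith)
    rw [frequently_atTop]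
    intro i₀
    obtain ⟨n, ⟨hn1, hn2⟩, hn3⟩ := ((ev1.and ev).and (eventually_ge_atTop (i₀ + k))).exists
    by_contra hcon
    push Not at hcon
    set r := (1 - δ j) * τ n with hr
    have rpos : 0 < r := mul_pos (by linarith) (τpos n)
    have nn : ∀ i, 0 ≤ d i (p i * r) := fun i =>
      h.nonneg _ _ (mul_pos (h.p_pos i) rpos).le
    have ln : ∀ i, d i (p i * r) ≤ 1 := fun i =>
      h.le_one _ _ (mul_pos (h.p_pos i) rpos).le
    have h1 := h.prod_upper n r rpos.le
    rw [prod_range_succ_split _ (by omega : k ≤ n)] at h1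
    have h2 : 1 / 2 ≤ ∏ i ∈ Finset.range (n + 1 - k), (1 - d i (p i * r)) := by
      have h3 := prod_one_sub_ge (Finset.range (n + 1 - k)) (fun i => d i (p i * r))
        (fun i _ => nn i) (fun i _ => ln i)
      have h4 := htail n k r rpos
      have h5 : E n / r ≤ 4 := by
        rw [div_le_iff₀ rpos]
        have := mul_le_mul_of_nonneg_right aj (τpos n).le
        simp only [hr]; linarith
      have h6 : G * (E n / r) * ρ ^ k ≤ 4 * G * ρ ^ k := by
        have := mul_le_mul_of_nonneg_left h5 (mul_nonneg hG.le (pow_nonneg hρ0.le k))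
        linarith
      linarith
    have h3 : δ j ^ k ≤ ∏ l ∈ Finset.range k, (1 - d (n - l) (p (n - l) * r)) := by
      have : δ j ^ k = ∏ _l ∈ Finset.range k, δ j := by simp
      rw [this]
      refine Finset.prod_le_prod (fun _ _ => (δpos j).le) fun l hl => ?_
      have hl' := Finset.mem_range.1 hl
      have := hcon (n - l) (by omega) n (by omega)
      linarith
    have h4 := mul_le_mul h2 h3 dk.le (by linarith)
    linarith
  -- Diagonal choice: the `j`th selected chain `ξ j` lies in a product `ν j ≥ ξ j` and is unmixed up
  -- to `δ j`. Its cutoff time is inherited from that product.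
  obtain ⟨ξ, hξ, hgood⟩ := extraction_forall_of_frequently freq
  choose ν hν1 hν2 using hgood
  refine ⟨ξ, hξ, fun j => p (ξ j) * τ (ν j), fun j => mul_pos (h.p_pos _) (τpos _), ?_, ?_⟩
  · intro a ha
    have a0 : 0 < a := by linarith
    have hν : Tendsto ν atTop atTop :=
      tendsto_atTop_mono hν1 hξ.tendsto_atTop
    refine squeeze_zero (fun j => h.nonneg _ _ ?_) (fun j => ?_) ((hup a ha).comp hν)
    · exact (mul_pos a0 (mul_pos (h.p_pos _) (τpos _))).le
    · have := h.le_prod (ν j) (ξ j) (a * τ (ν j)) (mul_pos a0 (τpos _)).le (hν1 j)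
      rwa [show p (ξ j) * (a * τ (ν j)) = a * (p (ξ j) * τ (ν j)) by ring] at this
  · intro a ha0 ha1
    have δlim : Tendsto δ atTop (𝓝 0) := by
      have := (tendsto_const_div_atTop_nhds_zero_nat (1 : ℝ)).comp (tendsto_add_atTop_nat 2)
      refine this.congr fun j => ?_
      simp [hδ]
    have lim : Tendsto (fun j => 1 - δ j) atTop (𝓝 1) := by
      simpa using tendsto_const_nhds.sub δlim
    refine tendsto_of_tendsto_of_tendsto_of_le_of_le' lim tendsto_const_nhds ?_ ?_
    · filter_upwards [lim.eventually_const_lt ha1] with j hj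
      refine (hν2 j).trans (h.anti _ _ _ (mul_pos ha0 (mul_pos (h.p_pos _) (τpos _))).le ?_)
      have := mul_le_mul_of_nonneg_right hj.le (mul_pos (h.p_pos (ξ j)) (τpos (ν j))).le
      linarith
    · exact Eventually.of_forall fun j =>
        h.le_one _ _ (mul_pos ha0 (mul_pos (h.p_pos _) (τpos _))).le

end ProductFamily

/-! ### Stochastic kernels and their operators on bounded functions -/

section Kernels

variable {Y Z W : Type*}

/-- A stochastic kernel between two sets. -/
structure IsStoch (k : Y → Z → ℝ) : Prop where
  nonneg : ∀ y z, 0 ≤ k y z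
  row_sum : ∀ y, HasSum (k y) 1

/-- The action of a kernel on functions. -/
def act (k : Y → Z → ℝ) (f : Z → ℝ) (y : Y) : ℝ :=
  ∑' z, k y z * f z

theorem summable_mul_of_bounded {a f : Z → ℝ} {C : ℝ} (ha : Summable a)
    (hf : ∀ z, |f z| ≤ C) : Summable fun z => a z * f z := by
  refine Summable.of_norm_bounded (ha.abs.mul_right C) fun z => ?_
  rw [Real.norm_eq_abs, abs_mul]
  exact mul_le_mul_of_nonneg_left (hf z) (abs_nonneg _)

theorem IsStoch.abs_tsum_le {k : Y → Z → ℝ} (hk : IsStoch k) {f : Z → ℝ} {C : ℝ}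
    (hf : ∀ z, |f z| ≤ C) (y : Y) : |∑' z, k y z * f z| ≤ C := by
  have hs := summable_mul_of_bounded (hk.row_sum y).summable hf
  have h1 := norm_tsum_le_tsum_norm hs.norm
  refine h1.trans ?_
  have h2 : HasSum (fun z => k y z * C) C := by simpa using (hk.row_sum y).mul_right C
  rw [← h2.tsum_eq]
  refine Summable.tsum_le_tsum (fun z => ?_) hs.norm h2.summable
  rw [Real.norm_eq_abs, abs_mul, abs_of_nonneg (hk.nonneg y z)]
  exact mul_le_mul_of_nonneg_left (hf z) (hk.nonneg y z)

theorem IsStoch.summable_uncurry {a : Z → ℝ} {l : Z → W → ℝ} (ha : Summable a)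
    (hl : IsStoch l) : Summable (Function.uncurry fun z w => a z * l z w) := by
  rw [← summable_abs_iff]
  refine (summable_prod_of_nonneg fun _ => abs_nonneg _).2 ⟨fun z => ?_, ?_⟩
  · exact ((hl.row_sum z).summable.mul_left (a z)).abs
  · refine ha.abs.congr fun z => ?_
    have : ∀ w, |Function.uncurry (fun z w => a z * l z w) (z, w)| = |a z| * l z w := fun w => by
      simp [abs_mul, abs_of_nonneg (hl.nonneg z w)]
    simp_rw [this]
    rw [tsum_mul_left, (hl.row_sum z).tsum_eq, mul_one]

theorem IsStoch.tsum_mul_act {a : Z → ℝ} {l : Z → W → ℝ} (ha : Summable a)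
    (hl : IsStoch l) {f : W → ℝ} {C : ℝ} (hf : ∀ w, |f w| ≤ C) :
    ∑' z, a z * act l f z = ∑' w, (∑' z, a z * l z w) * f w := by
  have hs : Summable (Function.uncurry fun z w => a z * l z w * f w) := by
    have := summable_mul_of_bounded (f := fun q : Z × W => f q.2)
      (hl.summable_uncurry ha) (fun q => hf q.2)
    exact this
  simp_rw [act, ← tsum_mul_left, ← tsum_mul_right, ← mul_assoc]
  exact hs.tsum_comm.symm

theorem IsStoch.hasSum_comp {a : Z → ℝ} {l : Z → W → ℝ} {s : ℝ} (ha : HasSum a s)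
    (hl : IsStoch l) : HasSum (fun w => ∑' z, a z * l z w) s := by
  have hs := hl.summable_uncurry ha.summable
  have h1 : HasSum (Function.uncurry fun z w => a z * l z w) s := by
    have h2 := hs.hasSum.prod_fiberwise (fun z => (hl.row_sum z).mul_left (a z))
    simp only [mul_one] at h2
    rw [ha.unique h2]
    exact hs.hasSum
  have h3 := (Equiv.prodComm W Z).hasSum_iff.2 h1
  refine h3.prod_fiberwise fun w => ?_
  exact (hs.prod_symm.prod_factor w).hasSum

theorem IsStoch.summable_comp {a : Z → ℝ} {l : Z → W → ℝ} (ha : Summable a)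
    (hl : IsStoch l) (w : W) : Summable fun z => a z * l z w :=
  (hl.summable_uncurry ha).prod_symm.prod_factor w

theorem isStoch_idMat : IsStoch (idMat : Y → Y → ℝ) where
  nonneg x y := by unfold idMat; split_ifs <;> norm_num
  row_sum x := by
    have h : HasSum (idMat x) (idMat x x) :=
      hasSum_single x fun y hy => by simp [idMat, Ne.symm hy]
    simpa [idMat] using h

end Kernels

/-- The Banach space of bounded functions. -/
abbrev Linf (X : Type*) := lp (fun _ : X => ℝ) ∞

section Operators

variable {X Y Z W : Type*}

theorem Linf.abs_apply_le (f : Linf X) (x : X) : |f x| ≤ ‖f‖ :=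
  lp.norm_apply_le_norm ENNReal.top_ne_zero f x

/-- A bounded function as an element of `Linf`. -/
def toLinf (f : X → ℝ) (C : ℝ) (hf : ∀ x, |f x| ≤ C) : Linf X :=
  ⟨f, memℓp_infty ⟨C, by rintro _ ⟨x, rfl⟩; exact hf x⟩⟩

@[simp]
theorem toLinf_apply (f : X → ℝ) (C : ℝ) (hf : ∀ x, |f x| ≤ C) (x : X) :
    toLinf f C hf x = f x := rfl

/-- The operator `f ↦ (y ↦ ∑ z, k(y, z) f(m(y, z)))` on bounded functions. -/
def IsStoch.opMap {k : Y → Z → ℝ} (hk : IsStoch k) (m : Y → Z → W) : Linf W →L[ℝ] Linf Y :=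
  LinearMap.mkContinuous
    { toFun := fun f => toLinf (fun y => ∑' z, k y z * f (m y z)) ‖f‖ fun y =>
        hk.abs_tsum_le (fun z => Linf.abs_apply_le f (m y z)) y
      map_add' := fun f g => by
        ext y
        simp only [toLinf_apply, lp.coeFn_add, Pi.add_apply, mul_add]
        exact Summable.tsum_add
          (summable_mul_of_bounded (hk.row_sum y).summable fun z => Linf.abs_apply_le f _)
          (summable_mul_of_bounded (hk.row_sum y).summable fun z => Linf.abs_apply_le g _)
      map_smul' := fun c f => by
        ext y
        simp only [toLinf_apply, lp.coeFn_smul, Pi.smul_apply, smul_eq_mul, RingHom.id_apply]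
        rw [← tsum_mul_left]
        exact tsum_congr fun z => by ring }
    1 fun f => by
      rw [one_mul]
      exact lp.norm_le_of_forall_le (norm_nonneg f) fun y =>
        hk.abs_tsum_le (fun z => Linf.abs_apply_le f (m y z)) y

/-- The operator of a stochastic kernel on bounded functions. -/
def IsStoch.op {k : Y → Z → ℝ} (hk : IsStoch k) : Linf Z →L[ℝ] Linf Y :=
  hk.opMap fun _ z => z

theorem IsStoch.op_apply {k : Y → Z → ℝ} (hk : IsStoch k) (f : Linf Z) (y : Y) :
    hk.op f y = act k f y := rfl

end Operators

/-! ### Exponentials of bounded operators -/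

section Exponential

variable {E F : Type*} [NormedAddCommGroup E] [NormedSpace ℝ E] [CompleteSpace E]
  [NormedAddCommGroup F] [NormedSpace ℝ F] [CompleteSpace F]

theorem exp_hasSum_apply (T : E →L[ℝ] E) (f : E) :
    HasSum (fun m : ℕ => ((m.factorial : ℝ)⁻¹) • (T ^ m) f) (NormedSpace.exp T f) := by
  have h := NormedSpace.exp_series_hasSum_exp' (𝕂 := ℝ) T
  exact h.mapL (ContinuousLinearMap.apply ℝ E f)

/-- Intertwining passes to powers, hence to the exponential series term by term. It serves for the
stationary distribution and for inserting one factor into a product. -/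
theorem exp_intertwine (J : E →L[ℝ] F) (S : E →L[ℝ] E) (T : F →L[ℝ] F)
    (h : ∀ f, J (S f) = T (J f)) (f : E) :
    J (NormedSpace.exp S f) = NormedSpace.exp T (J f) := by
  have hm : ∀ m f, J ((S ^ m) f) = (T ^ m) (J f) := by
    intro m
    induction m with
    | zero => intro f; simp
    | succ m ih =>
      intro f
      rw [pow_succ, pow_succ, mul_apply_eq_comp, mul_apply_eq_comp,
        ih, h]
  have h1 := (exp_hasSum_apply S f).mapL J
  have h2 := exp_hasSum_apply T (J f)
  refine h1.unique ?_
  simpa only [map_smul, hm] using h2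

theorem clm_exp_add_of_commute {S T : E →L[ℝ] E} (h : Commute S T) :
    NormedSpace.exp (S + T) = NormedSpace.exp S * NormedSpace.exp T := by
  let _ : NormedAlgebra ℚ (E →L[ℝ] E) := NormedAlgebra.restrictScalars ℚ ℝ _
  exact NormedSpace.exp_add_of_commute h

theorem clm_exp_smul_one (c : ℝ) :
    NormedSpace.exp (c • (1 : E →L[ℝ] E)) = Real.exp c • (1 : E →L[ℝ] E) := by
  have h := NormedSpace.algebraMap_exp_comm (𝕂 := ℝ) (𝔸 := E →L[ℝ] E) c
  rw [Algebra.algebraMap_eq_smul_one, Algebra.algebraMap_eq_smul_one] at h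
  rw [← h, Real.exp_eq_exp_ℝ]

theorem clm_exp_add_smul (T : E →L[ℝ] E) (s t : ℝ) :
    NormedSpace.exp ((s + t) • T) = NormedSpace.exp (s • T) * NormedSpace.exp (t • T) := by
  rw [add_smul, clm_exp_add_of_commute]
  exact ((Commute.refl _).smul_left s).smul_right t

theorem exp_smul_sub_one_hasSum_apply (T : E →L[ℝ] E) (t : ℝ) (f : E) :
    HasSum (fun m : ℕ => (Real.exp (-t) * (t ^ m / (m.factorial : ℝ))) • (T ^ m) f)
      (NormedSpace.exp (t • (T - 1)) f) := by
  have h1 : NormedSpace.exp (t • (T - 1)) = Real.exp (-t) • NormedSpace.exp (t • T) := by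
    have h2 : t • (T - 1) = t • T + (-t) • (1 : E →L[ℝ] E) := by
      rw [smul_sub, neg_smul, sub_eq_add_neg]
    rw [h2, clm_exp_add_of_commute ((Commute.one_right _).smul_right _),
      clm_exp_smul_one, mul_smul_comm, mul_one]
  have h2 := (exp_hasSum_apply (t • T) f).const_smul (Real.exp (-t))
  have h3 : (fun m : ℕ => (Real.exp (-t) * (t ^ m / (m.factorial : ℝ))) • (T ^ m) f)
      = fun m : ℕ => Real.exp (-t) • ((m.factorial : ℝ)⁻¹) • ((t • T) ^ m) f := by
    funext m
    rw [smul_pow, smul_apply, smul_smul, smul_smul]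
    congr 1
    ring
  rw [h1, h3]
  exact h2

end Exponential

/-! ### The heat semigroup -/

section Heat

variable {X : Type*} {K : X → X → ℝ}

theorem IsStoch.stepPow (hK : IsStoch K) (m : ℕ) : IsStoch (stepPow K m) := by
  induction m with
  | zero => exact isStoch_idMat
  | succ m ih =>
    exact ⟨fun x y => tsum_nonneg fun z => mul_nonneg (hK.nonneg x z) (ih.nonneg z y),
      fun x => ih.hasSum_comp (hK.row_sum x)⟩

theorem act_idMat (f : X → ℝ) (x : X) : act idMat f x = f x := by
  rw [act, tsum_eq_single x fun y hy => by simp [idMat, Ne.symm hy]]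
  simp [idMat]

theorem IsStoch.op_pow_apply (hK : IsStoch K) (m : ℕ) (f : Linf X) (x : X) :
    (hK.op ^ m) f x = act (ProductChain.stepPow K m) f x := by
  induction m generalizing x with
  | zero => exact (act_idMat _ x).symm
  | succ m ih =>
    rw [pow_succ', mul_apply_eq_comp, IsStoch.op_apply]
    have : act K ((hK.op ^ m) f) x = ∑' z, K x z * act (ProductChain.stepPow K m) f z :=
      tsum_congr fun z => by rw [ih]
    rw [this, (hK.stepPow m).tsum_mul_act (hK.row_sum x).summable (Linf.abs_apply_le f)]
    rfl

/-- The heat semigroup on bounded functions. -/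
def IsStoch.heatOp (hK : IsStoch K) (t : ℝ) : Linf X →L[ℝ] Linf X :=
  NormedSpace.exp (t • (hK.op - 1))

theorem IsStoch.heatOp_add (hK : IsStoch K) (s t : ℝ) :
    hK.heatOp (s + t) = hK.heatOp s * hK.heatOp t :=
  clm_exp_add_smul _ s t

theorem hasSum_poisson (t : ℝ) :
    HasSum (fun m : ℕ => Real.exp (-t) * (t ^ m / (m.factorial : ℝ))) 1 := by
  have h := (NormedSpace.expSeries_div_hasSum_exp t).mul_left (Real.exp (-t))
  rwa [← Real.exp_eq_exp_ℝ, ← Real.exp_add, neg_add_cancel, Real.exp_zero] at h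

theorem IsStoch.hasSum_heatOp (hK : IsStoch K) (t : ℝ) (f : Linf X) (x : X) :
    HasSum (fun m : ℕ => Real.exp (-t) * (t ^ m / (m.factorial : ℝ)) *
      act (ProductChain.stepPow K m) f x) (hK.heatOp t f x) := by
  have h := (exp_smul_sub_one_hasSum_apply hK.op t f).mapL (lp.evalCLM ℝ (fun _ : X => ℝ) ∞ x)
  have h1 : (fun m : ℕ => Real.exp (-t) * (t ^ m / (m.factorial : ℝ)) *
      act (ProductChain.stepPow K m) f x) = fun m : ℕ => lp.evalCLM ℝ (fun _ : X => ℝ) ∞ x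
        ((Real.exp (-t) * (t ^ m / (m.factorial : ℝ))) • (hK.op ^ m) f) := by
    funext m
    rw [← hK.op_pow_apply m f x]
    rfl
  rw [h1]
  exact h

theorem IsStoch.heatOp_apply (hK : IsStoch K) (t : ℝ) (f : Linf X) (x : X) :
    hK.heatOp t f x = act (heat K t) f x := by
  rw [← (hK.hasSum_heatOp t f x).tsum_eq]
  exact IsStoch.tsum_mul_act (l := fun m => ProductChain.stepPow K m x)
    (hasSum_poisson t).summable ⟨fun m => (hK.stepPow m).nonneg x, fun m => (hK.stepPow m).row_sum x⟩
    (Linf.abs_apply_le f)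

theorem IsStoch.heat (hK : IsStoch K) {t : ℝ} (ht : 0 ≤ t) : IsStoch (heat K t) where
  nonneg x y := tsum_nonneg fun m => mul_nonneg (by positivity) ((hK.stepPow m).nonneg x y)
  row_sum x := IsStoch.hasSum_comp (l := fun m => ProductChain.stepPow K m x)
    (hasSum_poisson t) ⟨fun m => (hK.stepPow m).nonneg x, fun m => (hK.stepPow m).row_sum x⟩

theorem abs_idMat_le {Y : Type*} (x y : Y) : |idMat x y| ≤ 1 := by
  unfold idMat; split_ifs <;> norm_num

/-- The indicator function of a point. -/
def delta (y : X) : Linf X := toLinf (fun x => idMat x y) 1 fun x => abs_idMat_le x y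

theorem act_delta {W : Type*} (k : W → X → ℝ) (y : X) (w : W) : act k (delta y) w = k w y := by
  rw [act, tsum_eq_single y fun z hz => by simp [delta, idMat, hz]]
  simp [delta, idMat]

theorem IsStoch.heatOp_delta (hK : IsStoch K) (t : ℝ) (x y : X) :
    hK.heatOp t (delta y) x = ProductChain.heat K t x y := by
  rw [hK.heatOp_apply, act_delta]

/-- The semigroup property. -/
theorem IsStoch.heat_add (hK : IsStoch K) (s t : ℝ) (x y : X) :
    ProductChain.heat K (s + t) x y
      = ∑' z, ProductChain.heat K s x z * ProductChain.heat K t z y := by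
  rw [← hK.heatOp_delta, hK.heatOp_add, mul_apply_eq_comp, hK.heatOp_apply]
  exact tsum_congr fun z => by rw [hK.heatOp_delta]

theorem IsStoch.heat_stationary (hK : IsStoch K) {π : X → ℝ} (h0 : ∀ x, 0 ≤ π x)
    (h1 : HasSum π 1) (hst : ∀ y, HasSum (fun x => π x * K x y) (π y)) (t : ℝ) (y : X) :
    ∑' x, π x * ProductChain.heat K t x y = π y := by
  -- Viewed as a kernel from a point, `π` intertwines `t • (K - 1)` with `0`, whose exponential is
  -- the identity.
  have hπ : IsStoch (fun _ : Unit => π) := ⟨fun _ => h0, fun _ => h1⟩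
  have key := exp_intertwine hπ.op (t • (hK.op - 1)) 0 (fun f => by
    have h2 : hπ.op (hK.op f) = hπ.op f := by
      ext u
      rw [hπ.op_apply, hπ.op_apply]
      have h3 := hK.tsum_mul_act h1.summable (Linf.abs_apply_le f)
      have h4 : ∀ w, ∑' z, π z * K z w = π w := fun w => (hst w).tsum_eq
      simp_rw [h4] at h3
      exact h3
    simp [h2]) (delta y)
  rw [NormedSpace.exp_zero, one_apply_eq_self] at key
  have h2 := congrArg (fun g : Linf Unit => g ()) key
  simp only [hπ.op_apply, act_delta] at h2
  rw [← h2]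
  exact tsum_congr fun x => by rw [← hK.heatOp_delta]; rfl

end Heat

/-! ### The heat kernel of a product chain -/

section Exponential

variable {E F : Type*} [NormedAddCommGroup E] [NormedSpace ℝ E]
  [NormedAddCommGroup F] [NormedSpace ℝ F]

theorem smul_sum_sub_one {ι : Type*} (s : Finset ι) (w : ι → ℝ) (hw : ∑ i ∈ s, w i = 1)
    (T : ι → E →L[ℝ] E) (t : ℝ) :
    t • (∑ i ∈ s, w i • T i - 1) = ∑ i ∈ s, (t * w i) • (T i - 1) := by
  simp_rw [mul_smul, smul_sub, Finset.sum_sub_distrib, ← Finset.smul_sum, ← Finset.sum_smul, hw,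
    one_smul]

theorem exp_smul_intertwine [CompleteSpace E] [CompleteSpace F] (J : E →L[ℝ] F)
    (S : E →L[ℝ] E) (T : F →L[ℝ] F) (h : ∀ f, J (S f) = T (J f)) (c : ℝ) (f : E) :
    J (NormedSpace.exp (c • (S - 1)) f) = NormedSpace.exp (c • (T - 1)) (J f) := by
  refine exp_intertwine J _ _ (fun g => ?_) f
  simp [h]

theorem commute_smul_sub_one {S T : E →L[ℝ] E} (h : Commute S T) (a b : ℝ) :
    Commute (a • (S - 1)) (b • (T - 1)) := by
  have h1 : Commute (S - 1) T := h.sub_left (Commute.one_left T)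
  have h2 : Commute (S - 1) (T - 1) := h1.sub_right (Commute.one_right _)
  exact (h2.smul_left a).smul_right b

theorem exp_sum_insert [CompleteSpace E] {ι : Type*} [DecidableEq ι] {a : ι} {s : Finset ι}
    (ha : a ∉ s) (T : ι → E →L[ℝ] E) (h : ∀ i j, i ≠ j → Commute (T i) (T j)) (c : ι → ℝ) (f : E) :
    NormedSpace.exp (∑ i ∈ insert a s, c i • (T i - 1)) f
      = NormedSpace.exp (c a • (T a - 1)) (NormedSpace.exp (∑ i ∈ s, c i • (T i - 1)) f) := by
  rw [Finset.sum_insert ha, clm_exp_add_of_commute, mul_apply_eq_comp]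
  refine Commute.sum_right _ _ _ fun i hi => commute_smul_sub_one (h a i ?_) _ _
  rintro rfl
  exact ha hi

end Exponential

section Product

variable {ι : Type v} [Fintype ι] [DecidableEq ι] {Y : ι → Type u} {K : ∀ i, Y i → Y i → ℝ}

/-- Only the points that differ from `x` at most in the coordinate `i` contribute to the `i`th
summand of the product matrix. -/
theorem hasSum_coord (i : ι) (x : ∀ i, Y i) (f : (∀ i, Y i) → ℝ) {a : ℝ}
    (h : HasSum (fun z => K i (x i) z * f (Function.update x i z)) a) :
    HasSum (fun y : ∀ i, Y i =>
      (K i (x i) (y i) * ∏ j ∈ Finset.univ.erase i, idMat (x j) (y j)) * f y) a := by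
  -- The summand vanishes outside the range of `Function.update x i`, which reduces the sum to one
  -- over the `i`th coordinate.
  rw [← (Function.update_injective x i).hasSum_iff]
  · have e : ((fun y : ∀ i, Y i =>
        (K i (x i) (y i) * ∏ j ∈ Finset.univ.erase i, idMat (x j) (y j)) * f y) ∘
          Function.update x i) = fun z => K i (x i) z * f (Function.update x i z) := by
      funext z
      have h1 : ∏ j ∈ Finset.univ.erase i, idMat (x j) (Function.update x i z j) = 1 :=
        Finset.prod_eq_one fun j hj => by
          rw [Function.update_of_ne (Finset.ne_of_mem_erase hj)]
          simp [idMat]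
      simp only [Function.comp_apply, Function.update_self, h1, mul_one]
    rw [e]
    exact h
  · intro y hy
    obtain ⟨j, hji, hj⟩ : ∃ j, j ≠ i ∧ x j ≠ y j := by
      by_contra hcon
      push Not at hcon
      refine hy ⟨y i, ?_⟩
      ext j
      by_cases hji : j = i
      · subst hji; simp
      · simp [hji, hcon j hji]
    have : ∏ j ∈ Finset.univ.erase i, idMat (x j) (y j) = 0 :=
      Finset.prod_eq_zero (Finset.mem_erase.2 ⟨hji, Finset.mem_univ j⟩) (by simp [idMat, hj])
    simp [this]

theorem isStoch_coord (hK : ∀ i, IsStoch (K i)) (i : ι) :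
    IsStoch fun (x : ∀ i, Y i) (z : Y i) => K i (x i) z :=
  ⟨fun x => (hK i).nonneg (x i), fun x => (hK i).row_sum (x i)⟩

/-- The operator of the `i`th chain acting on the `i`th coordinate. -/
def coordOp (hK : ∀ i, IsStoch (K i)) (i : ι) : Linf (∀ i, Y i) →L[ℝ] Linf (∀ i, Y i) :=
  (isStoch_coord hK i).opMap fun x z => Function.update x i z

theorem coordOp_apply (hK : ∀ i, IsStoch (K i)) (i : ι) (f : Linf (∀ i, Y i)) (x : ∀ i, Y i) :
    coordOp hK i f x = ∑' z, K i (x i) z * f (Function.update x i z) := rfl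

theorem hasSum_prodMat (hK : ∀ i, IsStoch (K i)) (w : ι → ℝ) (f : Linf (∀ i, Y i))
    (x : ∀ i, Y i) :
    HasSum (fun y => prodMat w K x y * f y) (∑ i, w i * coordOp hK i f x) := by
  have h := hasSum_sum (s := Finset.univ) fun i _ =>
    (hasSum_coord (K := K) i x f (summable_mul_of_bounded ((hK i).row_sum (x i)).summable
      fun z => Linf.abs_apply_le f _).hasSum).mul_left (w i)
  have e : (fun y => prodMat w K x y * f y) = fun y => ∑ i, w i *
      ((K i (x i) (y i) * ∏ j ∈ Finset.univ.erase i, idMat (x j) (y j)) * f y) := by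
    funext y
    rw [prodMat, Finset.sum_mul]
    exact Finset.sum_congr rfl fun i _ => by ring
  rw [e]
  exact h

theorem idMat_nonneg {X : Type*} (x y : X) : 0 ≤ idMat x y := isStoch_idMat.nonneg x y

theorem isStoch_prodMat (hK : ∀ i, IsStoch (K i)) {w : ι → ℝ} (hw : ∀ i, 0 ≤ w i)
    (hw1 : ∑ i, w i = 1) : IsStoch (prodMat w K) where
  nonneg x y := Finset.sum_nonneg fun i _ => mul_nonneg (hw i)
    (mul_nonneg ((hK i).nonneg _ _) (Finset.prod_nonneg fun j _ => idMat_nonneg _ _))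
  row_sum x := by
    have h := hasSum_prodMat hK w (toLinf (fun _ => 1) 1 (by simp)) x
    simp only [coordOp_apply, toLinf_apply, mul_one, fun i => ((hK i).row_sum (x i)).tsum_eq,
      hw1] at h
    exact h

theorem op_prodMat (hK : ∀ i, IsStoch (K i)) {w : ι → ℝ} (hw : ∀ i, 0 ≤ w i)
    (hw1 : ∑ i, w i = 1) : (isStoch_prodMat hK hw hw1).op = ∑ i, w i • coordOp hK i := by
  ext f x
  rw [IsStoch.op_apply, act, (hasSum_prodMat hK w f x).tsum_eq, sum_apply]
  rw [lp.coeFn_sum, Finset.sum_apply]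
  rfl

theorem coordOp_comp_apply (hK : ∀ i, IsStoch (K i)) {i j : ι} (hij : i ≠ j)
    (f : Linf (∀ i, Y i)) (x : ∀ i, Y i) :
    coordOp hK i (coordOp hK j f) x = ∑' z, ∑' w,
      K i (x i) z * (K j (x j) w * f (Function.update (Function.update x i z) j w)) := by
  rw [coordOp_apply]
  refine tsum_congr fun z => ?_
  rw [coordOp_apply, ← tsum_mul_left, Function.update_of_ne hij.symm]

/-- Updates at different coordinates commute; boundedness of `f` makes the double series absolutely
summable, so the sums may be exchanged. -/
theorem coordOp_commute (hK : ∀ i, IsStoch (K i)) {i j : ι} (hij : i ≠ j) :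
    Commute (coordOp hK i) (coordOp hK j) := by
  ext f x
  rw [mul_apply_eq_comp, mul_apply_eq_comp, coordOp_comp_apply hK hij,
    coordOp_comp_apply hK hij.symm]
  have hs : Summable (Function.uncurry fun z w =>
      K i (x i) z * (K j (x j) w * f (Function.update (Function.update x i z) j w))) := by
    have h := summable_mul_of_bounded
      (f := fun q : Y i × Y j => f (Function.update (Function.update x i q.1) j q.2))
      (IsStoch.summable_uncurry (l := fun _ : Y i => K j (x j)) ((hK i).row_sum (x i)).summable
        ⟨fun _ => (hK j).nonneg _, fun _ => (hK j).row_sum _⟩)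
      (fun q => Linf.abs_apply_le f _)
    refine h.congr fun q => ?_
    simp only [Function.uncurry, mul_assoc]
  rw [← hs.tsum_comm]
  refine tsum_congr fun w => tsum_congr fun z => ?_
  rw [Function.update_comm hij]
  ring

/-- The product function `y ↦ ∏ i, f i (y i)`. -/
def tensor (f : ∀ i, Linf (Y i)) : Linf (∀ i, Y i) :=
  toLinf (fun y => ∏ i, f i (y i)) (∏ i, ‖f i‖) fun y => by
    rw [Finset.abs_prod]
    exact Finset.prod_le_prod (fun i _ => abs_nonneg _) fun i _ => Linf.abs_apply_le _ _

theorem tensor_apply (f : ∀ i, Linf (Y i)) (y : ∀ i, Y i) : tensor f y = ∏ i, f i (y i) := rfl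

/-- The product function as a function of the `i`th factor. -/
def insertAt (f : ∀ i, Linf (Y i)) (i : ι) : Linf (Y i) →L[ℝ] Linf (∀ i, Y i) :=
  have bound : ∀ (g : Linf (Y i)) (y : ∀ i, Y i),
      |(∏ j ∈ Finset.univ.erase i, f j (y j)) * g (y i)|
        ≤ (∏ j ∈ Finset.univ.erase i, ‖f j‖) * ‖g‖ := fun g y => by
    rw [abs_mul, Finset.abs_prod]
    exact mul_le_mul (Finset.prod_le_prod (fun i _ => abs_nonneg _)
      fun i _ => Linf.abs_apply_le _ _) (Linf.abs_apply_le _ _) (abs_nonneg _)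
      (Finset.prod_nonneg fun _ _ => norm_nonneg _)
  LinearMap.mkContinuous
    { toFun := fun g => toLinf (fun y => (∏ j ∈ Finset.univ.erase i, f j (y j)) * g (y i))
        ((∏ j ∈ Finset.univ.erase i, ‖f j‖) * ‖g‖) (bound g)
      map_add' := fun g h => by
        ext y
        simp only [toLinf_apply, lp.coeFn_add, Pi.add_apply, mul_add]
      map_smul' := fun c g => by
        ext y
        simp only [toLinf_apply, lp.coeFn_smul, Pi.smul_apply, smul_eq_mul, RingHom.id_apply]
        ring }
    (∏ j ∈ Finset.univ.erase i, ‖f j‖) fun g =>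
      lp.norm_le_of_forall_le (mul_nonneg (Finset.prod_nonneg fun _ _ => norm_nonneg _)
        (norm_nonneg g)) (bound g)

theorem insertAt_apply (f : ∀ i, Linf (Y i)) (i : ι) (g : Linf (Y i)) (y : ∀ i, Y i) :
    insertAt f i g y = (∏ j ∈ Finset.univ.erase i, f j (y j)) * g (y i) := rfl

theorem insertAt_eq_tensor (f : ∀ i, Linf (Y i)) (i : ι) (g : Linf (Y i)) :
    insertAt f i g = tensor (Function.update f i g) := by
  ext y
  rw [insertAt_apply, tensor_apply, ← Finset.mul_prod_erase _ _ (Finset.mem_univ i),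
    Function.update_self, mul_comm]
  congr 1
  exact Finset.prod_congr rfl fun j hj => by
    rw [Function.update_of_ne (Finset.ne_of_mem_erase hj)]

theorem insertAt_op (hK : ∀ i, IsStoch (K i)) (f : ∀ i, Linf (Y i)) (i : ι) (g : Linf (Y i)) :
    insertAt f i ((hK i).op g) = coordOp hK i (insertAt f i g) := by
  ext x
  rw [insertAt_apply, coordOp_apply, IsStoch.op_apply, act, ← tsum_mul_left]
  refine tsum_congr fun z => ?_
  rw [insertAt_apply, Function.update_self]
  have : ∏ j ∈ Finset.univ.erase i, f j (Function.update x i z j)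
      = ∏ j ∈ Finset.univ.erase i, f j (x j) := Finset.prod_congr rfl fun j hj => by
    rw [Function.update_of_ne (Finset.ne_of_mem_erase hj)]
  rw [this]
  ring

/-- The coordinate operators commute, so the exponential splits into one factor per coordinate; by
`insertAt_op`, the factor at `a` acts only on the `a`th function of the tensor product. -/
theorem exp_sum_coordOp_tensor (hK : ∀ i, IsStoch (K i)) (c : ι → ℝ) (f : ∀ i, Linf (Y i))
    (s : Finset ι) :
    NormedSpace.exp (∑ i ∈ s, c i • (coordOp hK i - 1)) (tensor f)
      = tensor fun i => if i ∈ s then (hK i).heatOp (c i) (f i) else f i := by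
  induction s using Finset.induction_on with
  | empty =>
    rw [Finset.sum_empty, NormedSpace.exp_zero]
    simp
  | insert a s ha ih =>
    rw [exp_sum_insert ha _ (fun i j hij => coordOp_commute hK hij), ih]
    set g : ∀ i, Linf (Y i) := fun i => if i ∈ s then (hK i).heatOp (c i) (f i) else f i with hg
    have h1 : tensor g = insertAt g a (f a) := by
      rw [insertAt_eq_tensor]
      congr 1
      rw [eq_comm, Function.update_eq_self_iff]
      simp [hg, ha]
    rw [h1, ← exp_smul_intertwine (insertAt g a) (hK a).op (coordOp hK a) (insertAt_op hK g a),
      insertAt_eq_tensor]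
    congr 1
    ext1 i
    by_cases hi : i = a
    · subst hi
      simp [IsStoch.heatOp]
    · simp [hi, hg]

/-- The heat kernel of a product is the product of the heat kernels. -/
theorem heat_prodMat (hK : ∀ i, IsStoch (K i)) {w : ι → ℝ} (hw : ∀ i, 0 ≤ w i)
    (hw1 : ∑ i, w i = 1) (t : ℝ) (x y : ∀ i, Y i) :
    heat (prodMat w K) t x y = ∏ i, heat (K i) (t * w i) (x i) (y i) := by
  -- A point mass on the product is a tensor product, so kernel entries can be read off from the
  -- tensor formula.
  have hd : delta y = tensor fun i => delta (y i) := by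
    ext z
    rw [tensor_apply]
    simp only [delta, toLinf_apply, idMat]
    by_cases h : z = y
    · subst h; simp
    · rw [if_neg h]
      obtain ⟨i, hi⟩ := Function.ne_iff.1 h
      exact (Finset.prod_eq_zero (Finset.mem_univ i) (by simp [hi])).symm
  rw [← (isStoch_prodMat hK hw hw1).heatOp_delta, IsStoch.heatOp, op_prodMat hK hw hw1,
    smul_sum_sub_one _ _ hw1, hd, exp_sum_coordOp_tensor, tensor_apply]
  refine Finset.prod_congr rfl fun i _ => ?_
  rw [if_pos (Finset.mem_univ i), IsStoch.heatOp_delta]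

end Product

/-! ### Affinities of distributions -/

/-- A probability distribution on a set. -/
structure IsProb {Y : Type*} (a : Y → ℝ) : Prop where
  nonneg : ∀ y, 0 ≤ a y
  sum : HasSum a 1

theorem IsStoch.isProb {Y Z : Type*} {k : Y → Z → ℝ} (hk : IsStoch k) (y : Y) : IsProb (k y) :=
  ⟨hk.nonneg y, hk.row_sum y⟩

/-- Superadditive homogeneous functions of two nonnegative numbers that are compatible with
products, such as the minimum and the geometric mean. -/
structure IsAffinity (φ : ℝ → ℝ → ℝ) : Prop where
  nonneg : ∀ {a b}, 0 ≤ a → 0 ≤ b → 0 ≤ φ a b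
  le_add : ∀ {a b}, 0 ≤ a → 0 ≤ b → φ a b ≤ a + b
  one : φ 1 1 = 1
  mono : ∀ {a b c d}, 0 ≤ a → 0 ≤ b → a ≤ c → b ≤ d → φ a b ≤ φ c d
  superadd : ∀ {a b c d}, 0 ≤ a → 0 ≤ b → 0 ≤ c → 0 ≤ d → φ a b + φ c d ≤ φ (a + c) (b + d)
  homog : ∀ {a b c}, 0 ≤ a → 0 ≤ b → 0 ≤ c → φ a b * c = φ (a * c) (b * c)
  mul_le : ∀ {a b c d}, 0 ≤ a → 0 ≤ b → 0 ≤ c → 0 ≤ d → φ a b * φ c d ≤ φ (a * c) (b * d)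

theorem isAffinity_min : IsAffinity min where
  nonneg := le_min
  le_add h1 h2 := (min_le_left _ _).trans (by linarith)
  one := min_self 1
  mono _ _ h1 h2 := min_le_min h1 h2
  superadd _ _ _ _ := le_min (add_le_add (min_le_left _ _) (min_le_left _ _))
    (add_le_add (min_le_right _ _) (min_le_right _ _))
  homog _ _ hc := min_mul_of_nonneg _ _ hc
  mul_le ha hb hc hd := le_min
    (mul_le_mul (min_le_left _ _) (min_le_left _ _) (le_min hc hd) ha)
    (mul_le_mul (min_le_right _ _) (min_le_right _ _) (le_min hc hd) hb)

/-- The geometric mean. -/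
def geomMean (a b : ℝ) : ℝ := Real.sqrt a * Real.sqrt b

theorem isAffinity_geomMean : IsAffinity geomMean where
  nonneg _ _ := mul_nonneg (Real.sqrt_nonneg _) (Real.sqrt_nonneg _)
  le_add {a b} ha hb := by
    unfold geomMean
    nlinarith [Real.sq_sqrt ha, Real.sq_sqrt hb, sq_nonneg (√a - √b), sq_nonneg (√a + √b)]
  one := by simp [geomMean]
  mono _ _ h1 h2 := mul_le_mul (Real.sqrt_le_sqrt h1) (Real.sqrt_le_sqrt h2)
    (Real.sqrt_nonneg _) (Real.sqrt_nonneg _)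
  superadd {a b c d} ha hb hc hd := by
    unfold geomMean
    rw [← Real.sqrt_mul (add_nonneg ha hc)]
    refine Real.le_sqrt_of_sq_le ?_
    nlinarith [Real.sq_sqrt ha, Real.sq_sqrt hb, Real.sq_sqrt hc, Real.sq_sqrt hd,
      sq_nonneg (√a * √d - √c * √b)]
  homog {a b c} ha hb hc := by
    unfold geomMean
    rw [Real.sqrt_mul ha, Real.sqrt_mul hb, mul_mul_mul_comm, Real.mul_self_sqrt hc]
  mul_le {a b c d} ha hb hc hd := by
    unfold geomMean
    rw [Real.sqrt_mul ha, Real.sqrt_mul hb, mul_mul_mul_comm]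

theorem min_le_geomMean {a b : ℝ} (ha : 0 ≤ a) (hb : 0 ≤ b) : min a b ≤ geomMean a b := by
  rw [← Real.mul_self_sqrt (le_min ha hb)]
  exact mul_le_mul (Real.sqrt_le_sqrt (min_le_left _ _)) (Real.sqrt_le_sqrt (min_le_right _ _))
    (Real.sqrt_nonneg _) (Real.sqrt_nonneg _)

/-- The affinity of two distributions. -/
def aff {Y : Type*} (φ : ℝ → ℝ → ℝ) (a b : Y → ℝ) : ℝ :=
  ∑' y, φ (a y) (b y)

namespace IsAffinity

variable {φ : ℝ → ℝ → ℝ} {Y Z : Type*} {a b : Y → ℝ}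

theorem summable (h : IsAffinity φ) (ha : ∀ y, 0 ≤ a y) (hb : ∀ y, 0 ≤ b y)
    (has : Summable a) (hbs : Summable b) : Summable fun y => φ (a y) (b y) :=
  Summable.of_nonneg_of_le (fun y => h.nonneg (ha y) (hb y)) (fun y => h.le_add (ha y) (hb y))
    (has.add hbs)

/-- Superadditivity gives the bound on finite sets, and monotonicity replaces the partial sums by
the full ones. -/
theorem tsum_le (h : IsAffinity φ) (ha : ∀ y, 0 ≤ a y) (hb : ∀ y, 0 ≤ b y)
    (has : Summable a) (hbs : Summable b) :
    ∑' y, φ (a y) (b y) ≤ φ (∑' y, a y) (∑' y, b y) := by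
  classical
  refine Real.tsum_le_of_sum_le (fun y => h.nonneg (ha y) (hb y)) fun s => ?_
  have h1 : ∑ y ∈ s, φ (a y) (b y) ≤ φ (∑ y ∈ s, a y) (∑ y ∈ s, b y) := by
    induction s using Finset.induction_on with
    | empty => simpa using h.nonneg le_rfl le_rfl
    | insert y s hy ih =>
      rw [Finset.sum_insert hy, Finset.sum_insert hy, Finset.sum_insert hy]
      refine (add_le_add_right ih _).trans (h.superadd (ha y) (hb y) ?_ ?_)
      · exact Finset.sum_nonneg fun i _ => ha i
      · exact Finset.sum_nonneg fun i _ => hb i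
  exact h1.trans (h.mono (Finset.sum_nonneg fun i _ => ha i) (Finset.sum_nonneg fun i _ => hb i)
    (has.sum_le_tsum _ fun i _ => ha i) (hbs.sum_le_tsum _ fun i _ => hb i))

theorem aff_nonneg (h : IsAffinity φ) (ha : IsProb a) (hb : IsProb b) : 0 ≤ aff φ a b :=
  tsum_nonneg fun y => h.nonneg (ha.nonneg y) (hb.nonneg y)

theorem aff_le_one (h : IsAffinity φ) (ha : IsProb a) (hb : IsProb b) : aff φ a b ≤ 1 := by
  have := h.tsum_le ha.nonneg hb.nonneg ha.sum.summable hb.sum.summable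
  rwa [ha.sum.tsum_eq, hb.sum.tsum_eq, h.one] at this

/-- The affinity does not decrease when both distributions are transported by a kernel. -/
theorem aff_le_aff_comp (h : IsAffinity φ) (ha : IsProb a) (hb : IsProb b) {l : Y → Z → ℝ}
    (hl : IsStoch l) :
    aff φ a b ≤ aff φ (fun z => ∑' y, a y * l y z) (fun z => ∑' y, b y * l y z) := by
  have hs := h.summable ha.nonneg hb.nonneg ha.sum.summable hb.sum.summable
  have h1 := hl.hasSum_comp hs.hasSum
  rw [aff, ← h1.tsum_eq]
  refine Summable.tsum_le_tsum (fun z => ?_) h1.summable ?_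
  · have h2 : ∀ y, φ (a y) (b y) * l y z = φ (a y * l y z) (b y * l y z) := fun y =>
      h.homog (ha.nonneg y) (hb.nonneg y) (hl.nonneg y z)
    simp_rw [h2]
    exact h.tsum_le (fun y => mul_nonneg (ha.nonneg y) (hl.nonneg y z))
      (fun y => mul_nonneg (hb.nonneg y) (hl.nonneg y z))
      (hl.summable_comp ha.sum.summable z) (hl.summable_comp hb.sum.summable z)
  · exact h.summable (fun z => tsum_nonneg fun y => mul_nonneg (ha.nonneg y) (hl.nonneg y z))
      (fun z => tsum_nonneg fun y => mul_nonneg (hb.nonneg y) (hl.nonneg y z))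
      (hl.hasSum_comp ha.sum).summable (hl.hasSum_comp hb.sum).summable

theorem prod_le (h : IsAffinity φ) {ι : Type*} (s : Finset ι) {a b : ι → ℝ}
    (ha : ∀ i, 0 ≤ a i) (hb : ∀ i, 0 ≤ b i) :
    ∏ i ∈ s, φ (a i) (b i) ≤ φ (∏ i ∈ s, a i) (∏ i ∈ s, b i) := by
  classical
  induction s using Finset.induction_on with
  | empty => simp [h.one]
  | insert i s hi ih =>
    rw [Finset.prod_insert hi, Finset.prod_insert hi, Finset.prod_insert hi]
    exact (mul_le_mul_of_nonneg_left ih (h.nonneg (ha i) (hb i))).trans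
      (h.mul_le (ha i) (hb i) (Finset.prod_nonneg fun i _ => ha i)
        (Finset.prod_nonneg fun i _ => hb i))

end IsAffinity

/-! ### Product distributions -/

theorem hasSum_pi_prod {n : ℕ} {Y : Fin n → Type u} (f : ∀ i, Y i → ℝ) (s : Fin n → ℝ)
    (h0 : ∀ i y, 0 ≤ f i y) (hf : ∀ i, HasSum (f i) (s i)) :
    HasSum (fun y : ∀ i, Y i => ∏ i, f i (y i)) (∏ i, s i) := by
  induction n with
  | zero =>
    simp
  | succ n ih =>
    rw [← (Fin.consEquiv Y).hasSum_iff, Fin.prod_univ_succ]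
    have h1 := ih (Y := fun i => Y i.succ) (fun i => f i.succ) (fun i => s i.succ)
      (fun i => h0 i.succ) (fun i => hf i.succ)
    have hg : (0 : (∀ i : Fin n, Y i.succ) → ℝ) ≤ fun y => ∏ i : Fin n, f i.succ (y i) :=
      fun y => Finset.prod_nonneg fun i _ => h0 _ _
    have hf0 : (0 : Y 0 → ℝ) ≤ f 0 := fun y => h0 0 y
    have hs := Summable.mul_of_nonneg (hf 0).summable h1.summable hf0 hg
    have h2 := (hf 0).mul h1 hs
    have e : ((fun y : ∀ i, Y i => ∏ i, f i (y i)) ∘ (Fin.consEquiv Y))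
        = fun q : Y 0 × (∀ i : Fin n, Y i.succ) => f 0 q.1 * ∏ i, f i.succ (q.2 i) := by
      funext q
      simp [Fin.prod_univ_succ, Fin.consEquiv]
    rw [e]
    exact h2

section Product

variable {n : ℕ} {Y : Fin n → Type u} {a b : ∀ i, Y i → ℝ} {φ : ℝ → ℝ → ℝ}

theorem isProb_pi (ha : ∀ i, IsProb (a i)) : IsProb fun y : ∀ i, Y i => ∏ i, a i (y i) where
  nonneg y := Finset.prod_nonneg fun i _ => (ha i).nonneg _
  sum := by
    have := hasSum_pi_prod a (fun _ => 1) (fun i => (ha i).nonneg) (fun i => (ha i).sum)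
    simpa using this

theorem IsAffinity.prod_aff_le (h : IsAffinity φ) (ha : ∀ i, IsProb (a i))
    (hb : ∀ i, IsProb (b i)) :
    ∏ i, aff φ (a i) (b i)
      ≤ aff φ (fun y : ∀ i, Y i => ∏ i, a i (y i)) (fun y => ∏ i, b i (y i)) := by
  have h1 := hasSum_pi_prod (fun i y => φ (a i y) (b i y)) (fun i => aff φ (a i) (b i))
    (fun i y => h.nonneg ((ha i).nonneg y) ((hb i).nonneg y))
    (fun i => (h.summable (ha i).nonneg (hb i).nonneg (ha i).sum.summable
      (hb i).sum.summable).hasSum)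
  rw [← h1.tsum_eq]
  refine Summable.tsum_le_tsum (fun y => ?_) h1.summable ?_
  · exact h.prod_le _ (fun i => (ha i).nonneg _) (fun i => (hb i).nonneg _)
  · exact h.summable (isProb_pi ha).nonneg (isProb_pi hb).nonneg (isProb_pi ha).sum.summable
      (isProb_pi hb).sum.summable

/-- This computes the `i`th marginal: the indicator is absorbed into the `i`th factor and the other
factors sum to `1`. -/
theorem tsum_pi_mul_idMat (ha : ∀ i, IsProb (a i)) (i : Fin n) (z : Y i) :
    ∑' y : ∀ i, Y i, (∏ j, a j (y j)) * idMat (y i) z = a i z := by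
  have hz : HasSum (fun y => a i y * idMat y z) (a i z) := by
    have h := hasSum_single (f := fun y => a i y * idMat y z) z
      fun y hy => by simp [idMat, hy]
    simpa [idMat] using h
  have h1 := hasSum_pi_prod (Function.update a i fun y => a i y * idMat y z)
    (Function.update (fun _ => 1) i (a i z))
    (fun j y => by
      by_cases hj : j = i
      · subst hj
        simpa using mul_nonneg ((ha j).nonneg y) (idMat_nonneg y z)
      · simpa [hj] using (ha j).nonneg y)
    (fun j => by
      by_cases hj : j = i
      · subst hj
        simpa using hz
      · simpa [hj] using (ha j).sum)
  rw [Finset.prod_update_of_mem (Finset.mem_univ i)] at h1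
  simp only [Finset.prod_const_one, mul_one] at h1
  rw [← h1.tsum_eq]
  refine tsum_congr fun y => ?_
  rw [← Finset.mul_prod_erase _ _ (Finset.mem_univ i),
    ← Finset.mul_prod_erase _ _ (Finset.mem_univ i), Function.update_self]
  have : ∏ j ∈ Finset.univ.erase i, Function.update a i (fun y => a i y * idMat y z) j (y j)
      = ∏ j ∈ Finset.univ.erase i, a j (y j) := Finset.prod_congr rfl fun j hj => by
    rw [Function.update_of_ne (Finset.ne_of_mem_erase hj)]
  rw [this]
  ring

/-- Projection to a coordinate is a kernel, and transport by a kernel does not decrease the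
affinity. -/
theorem IsAffinity.aff_pi_le (h : IsAffinity φ) (ha : ∀ i, IsProb (a i))
    (hb : ∀ i, IsProb (b i)) (i : Fin n) :
    aff φ (fun y : ∀ i, Y i => ∏ i, a i (y i)) (fun y => ∏ i, b i (y i))
      ≤ aff φ (a i) (b i) := by
  have h1 := h.aff_le_aff_comp (isProb_pi ha) (isProb_pi hb)
    (l := fun (y : ∀ i, Y i) (z : Y i) => idMat (y i) z)
    ⟨fun y => isStoch_idMat.nonneg (y i), fun y => isStoch_idMat.row_sum (y i)⟩
  simpa only [tsum_pi_mul_idMat ha, tsum_pi_mul_idMat hb] using h1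

end Product

/-! ### The affinity distance of a single chain -/

/-- The maximum over the starting points of one minus the affinity with the stationary
distribution. -/
def affDist {X : Type*} (φ : ℝ → ℝ → ℝ) (K : X → X → ℝ) (π : X → ℝ) (t : ℝ) : ℝ :=
  ⨆ x, (1 - aff φ (heat K t x) π)

/-- A stochastic matrix with a stationary distribution. -/
structure IsStatChain {X : Type*} (K : X → X → ℝ) (π : X → ℝ) : Prop where
  stoch : IsStoch K
  prob : IsProb π
  stat : ∀ t y, ∑' x, π x * heat K t x y = π y

theorem IsIrreducibleChain.isStatChain {X : Type*} {K : X → X → ℝ} {π : X → ℝ}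
    (h : IsIrreducibleChain K π) : IsStatChain K π where
  stoch := ⟨h.nonneg, h.row_sum⟩
  prob := ⟨h.prob_nonneg, h.prob_sum⟩
  stat := IsStoch.heat_stationary ⟨h.nonneg, h.row_sum⟩ h.prob_nonneg h.prob_sum h.stationary

theorem IsProb.nonempty {X : Type*} {π : X → ℝ} (h : IsProb π) : Nonempty X := by
  by_contra hX
  rw [not_nonempty_iff] at hX
  have h1 := h.sum.unique (hasSum_empty (f := π))
  exact one_ne_zero h1

section Single

variable {X : Type*} {K : X → X → ℝ} {π : X → ℝ} {φ : ℝ → ℝ → ℝ}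

theorem one_sub_aff_mem (hφ : IsAffinity φ) (hK : IsStoch K) (hπ : IsProb π) {t : ℝ}
    (ht : 0 ≤ t) (x : X) :
    0 ≤ 1 - aff φ (heat K t x) π ∧ 1 - aff φ (heat K t x) π ≤ 1 :=
  ⟨sub_nonneg.2 (hφ.aff_le_one ((hK.heat ht).isProb x) hπ),
    sub_le_self _ (hφ.aff_nonneg ((hK.heat ht).isProb x) hπ)⟩

theorem bddAbove_affDist (hφ : IsAffinity φ) (hK : IsStoch K) (hπ : IsProb π) {t : ℝ}
    (ht : 0 ≤ t) : BddAbove (Set.range fun x => 1 - aff φ (heat K t x) π) :=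
  ⟨1, by rintro _ ⟨x, rfl⟩; exact (one_sub_aff_mem hφ hK hπ ht x).2⟩

theorem le_affDist (hφ : IsAffinity φ) (hK : IsStoch K) (hπ : IsProb π) {t : ℝ}
    (ht : 0 ≤ t) (x : X) : 1 - aff φ (heat K t x) π ≤ affDist φ K π t :=
  le_ciSup (bddAbove_affDist hφ hK hπ ht) x

theorem affDist_le (hπ : IsProb π) {t c : ℝ} (h : ∀ x, 1 - aff φ (heat K t x) π ≤ c) :
    affDist φ K π t ≤ c :=
  haveI := hπ.nonempty
  ciSup_le h

theorem affDist_nonneg (hφ : IsAffinity φ) (hK : IsStoch K) (hπ : IsProb π) {t : ℝ}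
    (ht : 0 ≤ t) : 0 ≤ affDist φ K π t :=
  hπ.nonempty.elim fun x =>
    (one_sub_aff_mem hφ hK hπ ht x).1.trans (le_affDist hφ hK hπ ht x)

theorem affDist_le_one (hφ : IsAffinity φ) (hK : IsStoch K) (hπ : IsProb π) {t : ℝ}
    (ht : 0 ≤ t) : affDist φ K π t ≤ 1 :=
  affDist_le hπ fun x => (one_sub_aff_mem hφ hK hπ ht x).2

/-- Running the chain for the further time `t - s` is transport by a kernel that fixes `π`. -/
theorem affDist_anti (hφ : IsAffinity φ) (h : IsStatChain K π) {s t : ℝ}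
    (hs : 0 ≤ s) (hst : s ≤ t) : affDist φ K π t ≤ affDist φ K π s := by
  refine affDist_le h.prob fun x => le_trans ?_ (le_affDist hφ h.stoch h.prob hs x)
  have h1 := hφ.aff_le_aff_comp ((h.stoch.heat hs).isProb x) h.prob
    (h.stoch.heat (sub_nonneg.2 hst))
  simp only [h.stat, ← h.stoch.heat_add, add_sub_cancel] at h1
  linarith

/-- The Hellinger distance is dominated by the total variation. -/
theorem affDist_geomMean_le (h : IsStatChain K π) {t : ℝ} (ht : 0 ≤ t) :
    affDist geomMean K π t ≤ affDist min K π t := by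
  refine affDist_le h.prob fun x => le_trans ?_ (le_affDist isAffinity_min h.stoch h.prob ht x)
  have hp := (h.stoch.heat ht).isProb x
  refine sub_le_sub_left (Summable.tsum_le_tsum (fun y => ?_) ?_ ?_) 1
  · exact min_le_geomMean (hp.nonneg y) (h.prob.nonneg y)
  · exact isAffinity_min.summable hp.nonneg h.prob.nonneg hp.sum.summable h.prob.sum.summable
  · exact isAffinity_geomMean.summable hp.nonneg h.prob.nonneg hp.sum.summable
      h.prob.sum.summable

/-- A linear form of the bound of total variation by Hellinger, needed because submultiplicativity
is available only for the former. -/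
theorem affDist_min_le (h : IsStatChain K π) {t : ℝ} (ht : 0 ≤ t) :
    affDist min K π t ≤ 2 * affDist geomMean K π t + 1 / 4 := by
  refine affDist_le h.prob fun x => ?_
  have hx := le_affDist isAffinity_geomMean h.stoch h.prob ht x
  have hp := (h.stoch.heat ht).isProb x
  have hπ := h.prob
  have s1 := isAffinity_min.summable hp.nonneg hπ.nonneg hp.sum.summable hπ.sum.summable
  have s2 := isAffinity_geomMean.summable hp.nonneg hπ.nonneg hp.sum.summable hπ.sum.summable
  have h1 := (hp.sum.add hπ.sum).sub (s1.hasSum.mul_left 2)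
  -- Pointwise, `|a - b| = |√a - √b| * (√a + √b) ≤ 2 * (√a - √b)² + (√a + √b)² / 8`, and the right
  -- side is `17/8 * (a + b) - 15/4 * √(a * b)`. The difference of the two sides is an eighth of one
  -- of the squares used below.
  have h2 := ((hp.sum.add hπ.sum).mul_left (17 / 8)).sub (s2.hasSum.mul_left (15 / 4))
  have h3 := hasSum_le (fun y => ?_) h1 h2
  · have h4 : 0 ≤ aff geomMean (heat K t x) π := isAffinity_geomMean.aff_nonneg hp hπ
    have h5 : aff geomMean (heat K t x) π ≤ 1 := isAffinity_geomMean.aff_le_one hp hπ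
    simp only [aff] at *
    linarith
  · have ha := hp.nonneg y
    have hb := hπ.nonneg y
    generalize heat K t x y = a at *
    generalize π y = b at *
    have ea := Real.sq_sqrt ha
    have eb := Real.sq_sqrt hb
    simp only [geomMean]
    rcases le_total a b with hab | hab
    · rw [min_eq_left hab]
      nlinarith [sq_nonneg (5 * √a - 3 * √b), sq_nonneg (3 * √a - 5 * √b)]
    · rw [min_eq_right hab]
      nlinarith [sq_nonneg (5 * √a - 3 * √b), sq_nonneg (3 * √a - 5 * √b)]

end Single

/-! ### Total variation and its submultiplicativity -/

section TotalVariation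

variable {X : Type*} {K : X → X → ℝ} {π : X → ℝ} {a b f : X → ℝ}

theorem IsProb.hasSum_sub_min (ha : IsProb a) (hb : IsProb b) :
    HasSum (fun y => a y - min (a y) (b y)) (1 - aff min a b) :=
  ha.sum.sub (isAffinity_min.summable ha.nonneg hb.nonneg ha.sum.summable
    hb.sum.summable).hasSum

theorem aff_min_comm (a b : X → ℝ) : aff min a b = aff min b a := by
  simp only [aff, min_comm]

theorem tsum_mul_sub_le (ha : IsProb a) (hb : IsProb b) (h0 : ∀ y, 0 ≤ f y)
    (h1 : ∀ y, f y ≤ 1) : ∑' y, a y * f y - ∑' y, b y * f y ≤ 1 - aff min a b := by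
  have hf : ∀ y, |f y| ≤ 1 := fun y => abs_le.2 ⟨by linarith [h0 y], h1 y⟩
  have s1 := (summable_mul_of_bounded ha.sum.summable hf).hasSum
  have s2 := (summable_mul_of_bounded hb.sum.summable hf).hasSum
  refine hasSum_le (fun y => ?_) (s1.sub s2) (ha.hasSum_sub_min hb)
  have h2 := mul_le_mul_of_nonneg_right (min_le_right (a y) (b y)) (h0 y)
  have h3 := mul_le_mul_of_nonneg_left (h1 y) (sub_nonneg.2 (min_le_left (a y) (b y)))
  linarith

theorem abs_tsum_mul_sub_le (ha : IsProb a) (hb : IsProb b) (h0 : ∀ y, 0 ≤ f y)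
    (h1 : ∀ y, f y ≤ 1) : |∑' y, a y * f y - ∑' y, b y * f y| ≤ 1 - aff min a b := by
  refine abs_le.2 ⟨?_, tsum_mul_sub_le ha hb h0 h1⟩
  have := tsum_mul_sub_le hb ha h0 h1
  rw [aff_min_comm] at this
  linarith

theorem hasSum_abs_sub (ha : IsProb a) (hb : IsProb b) :
    HasSum (fun y => |a y - b y|) (2 * (1 - aff min a b)) := by
  have h := (ha.hasSum_sub_min hb).add (hb.hasSum_sub_min ha)
  rw [aff_min_comm b a, ← two_mul] at h
  have e : (fun y => |a y - b y|)
      = fun y => a y - min (a y) (b y) + (b y - min (b y) (a y)) := by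
    funext y
    rcases le_total (a y) (b y) with hab | hab
    · rw [min_eq_left hab, min_eq_right hab, abs_of_nonpos (by linarith)]; ring
    · rw [min_eq_right hab, min_eq_left hab, abs_of_nonneg (by linarith)]; ring
  rw [e]
  exact h

theorem tsum_mul_indicator (a : X → ℝ) (S : Set X) :
    ∑' y, a y * S.indicator (fun _ => 1) y = ∑' y : S, a y := by
  rw [tsum_subtype S a]
  refine tsum_congr fun y => ?_
  by_cases hy : y ∈ S <;> simp [hy]

theorem indicator_one_nonneg (S : Set X) (y : X) : 0 ≤ S.indicator (fun _ => (1 : ℝ)) y :=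
  Set.indicator_nonneg (fun _ _ => zero_le_one) y

theorem indicator_one_le (S : Set X) (y : X) : S.indicator (fun _ => (1 : ℝ)) y ≤ 1 := by
  by_cases hy : y ∈ S <;> simp [hy]

theorem abs_indicator_one_le (S : Set X) (y : X) : |S.indicator (fun _ => (1 : ℝ)) y| ≤ 1 :=
  abs_le.2 ⟨by linarith [indicator_one_nonneg S y], indicator_one_le S y⟩

/-- The total variation distance is attained at the set where the first density dominates. -/
theorem one_sub_aff_min_eq (ha : IsProb a) (hb : IsProb b) :
    1 - aff min a b = ∑' y, a y * {y | b y ≤ a y}.indicator (fun _ => 1) y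
      - ∑' y, b y * {y | b y ≤ a y}.indicator (fun _ => 1) y := by
  have s1 := (summable_mul_of_bounded ha.sum.summable
    (abs_indicator_one_le {y | b y ≤ a y})).hasSum
  have s2 := (summable_mul_of_bounded hb.sum.summable
    (abs_indicator_one_le {y | b y ≤ a y})).hasSum
  have h := ha.hasSum_sub_min hb
  have e : (fun y => a y - min (a y) (b y)) = fun y =>
      a y * {y | b y ≤ a y}.indicator (fun _ => (1 : ℝ)) y
        - b y * {y | b y ≤ a y}.indicator (fun _ => (1 : ℝ)) y := by
    funext y
    by_cases hy : b y ≤ a y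
    · simp [hy]
    · simp [hy, (not_le.1 hy).le]
  rw [e] at h
  exact h.unique (s1.sub s2)

theorem dTV_eq_affDist (hK : IsStoch K) (hπ : IsProb π) {t : ℝ} (ht : 0 ≤ t) :
    dTV K π t = affDist min K π t := by
  have hne := hπ.nonempty
  have key : ∀ q : X × Set X, (∑' y : q.2, heat K t q.1 y) - ∑' y : q.2, π y
      ≤ 1 - aff min (heat K t q.1) π := fun q => by
    rw [← tsum_mul_indicator, ← tsum_mul_indicator]
    exact tsum_mul_sub_le ((hK.heat ht).isProb q.1) hπ (indicator_one_nonneg _)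
      (indicator_one_le _)
  refine le_antisymm (ciSup_le fun q => (key q).trans (le_affDist isAffinity_min hK hπ ht q.1))
    (affDist_le hπ fun x => ?_)
  rw [one_sub_aff_min_eq ((hK.heat ht).isProb x) hπ, tsum_mul_indicator, tsum_mul_indicator]
  refine le_ciSup (f := fun q : X × Set X =>
    (∑' y : q.2, heat K t q.1 y) - ∑' y : q.2, π y) ⟨1, ?_⟩ (x, {y | π y ≤ heat K t x y})
  rintro _ ⟨q, rfl⟩
  exact (key q).trans (one_sub_aff_mem isAffinity_min hK hπ ht q.1).2

/-- Twice the maximum total variation is submultiplicative. -/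
theorem affDist_min_add_le (h : IsStatChain K π) {s t : ℝ} (hs : 0 ≤ s) (ht : 0 ≤ t) :
    affDist min K π (s + t) ≤ 2 * affDist min K π s * affDist min K π t := by
  refine affDist_le h.prob fun x => ?_
  have hps := (h.stoch.heat hs).isProb x
  rw [one_sub_aff_min_eq ((h.stoch.heat (add_nonneg hs ht)).isProb x) h.prob]
  set f : X → ℝ := {y | π y ≤ heat K (s + t) x y}.indicator (fun _ => 1) with hf
  have f0 : ∀ y, 0 ≤ f y := indicator_one_nonneg _
  have f1 : ∀ y, f y ≤ 1 := indicator_one_le _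
  have fb : ∀ y, |f y| ≤ 1 := abs_indicator_one_le _
  have e1 := (h.stoch.heat ht).tsum_mul_act hps.sum.summable fb
  have e2 := (h.stoch.heat ht).tsum_mul_act h.prob.sum.summable fb
  simp only [← h.stoch.heat_add] at e1
  simp only [h.stat] at e2
  rw [← e1, ← e2]
  set c := ∑' y, π y * f y
  have g1 : ∀ z, |act (heat K t) f z - c| ≤ affDist min K π t := fun z =>
    (abs_tsum_mul_sub_le ((h.stoch.heat ht).isProb z) h.prob f0 f1).trans
      (le_affDist isAffinity_min h.stoch h.prob ht z)
  have hab : ∀ z, |act (heat K t) f z| ≤ 1 := fun z => (h.stoch.heat ht).abs_tsum_le fb z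
  have s1 := (summable_mul_of_bounded hps.sum.summable hab).hasSum
  have s2 := (summable_mul_of_bounded h.prob.sum.summable hab).hasSum
  -- Both distributions have mass `1`, so the constant `c` may be subtracted from the function. What
  -- remains is at most the distance at time `t`, integrated against `|H_s - π|`, whose mass is
  -- twice a total variation.
  have s3 := (s1.sub s2).sub ((hps.sum.sub h.prob.sum).mul_right c)
  rw [sub_self, zero_mul, sub_zero] at s3
  have s4 := (hasSum_abs_sub hps h.prob).mul_right (affDist min K π t)
  have s5 := hasSum_le (fun z => ?_) s3 s4
  · refine s5.trans (mul_le_mul_of_nonneg_right ?_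
      (affDist_nonneg isAffinity_min h.stoch h.prob ht))
    exact mul_le_mul_of_nonneg_left (le_affDist isAffinity_min h.stoch h.prob hs x) two_pos.le
  · have e : heat K s x z * act (heat K t) f z - π z * act (heat K t) f z
        - (heat K s x z - π z) * c = (heat K s x z - π z) * (act (heat K t) f z - c) := by ring
    rw [e]
    refine (le_abs_self _).trans ?_
    rw [abs_mul]
    exact mul_le_mul_of_nonneg_left (g1 z) (abs_nonneg _)

theorem affDist_min_mul_le (h : IsStatChain K π) {s : ℝ} (hs : 0 ≤ s) (m : ℕ) :
    affDist min K π (m * s) ≤ (2 * affDist min K π s) ^ m := by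
  induction m with
  | zero => simpa using affDist_le_one isAffinity_min h.stoch h.prob le_rfl
  | succ m ih =>
    have h1 := affDist_min_add_le h (mul_nonneg (Nat.cast_nonneg m) hs) hs
    have h0 := affDist_nonneg isAffinity_min h.stoch h.prob hs
    rw [show ((m + 1 : ℕ) : ℝ) * s = m * s + s by push_cast; ring, pow_succ]
    have h2 := mul_le_mul_of_nonneg_right ih (mul_nonneg two_pos.le h0)
    linarith

end TotalVariation

/-! ### The Hellinger distance as an affinity distance -/

theorem dH_eq_sqrt_affDist {X : Type*} {K : X → X → ℝ} {π : X → ℝ} (hK : IsStoch K)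
    (hπ : IsProb π) {t : ℝ} (ht : 0 ≤ t) :
    dH K π t = Real.sqrt (affDist geomMean K π t) := by
  have hne := hπ.nonempty
  rw [affDist, Monotone.map_ciSup_of_continuousAt Real.continuous_sqrt.continuousAt
    (fun _ _ h => Real.sqrt_le_sqrt h) (bddAbove_affDist isAffinity_geomMean hK hπ ht), dH]
  congr 1
  funext x
  congr 1
  have hp := (hK.heat ht).isProb x
  have h := (((hp.sum.add hπ.sum).sub ((isAffinity_geomMean.summable hp.nonneg hπ.nonneg
    hp.sum.summable hπ.sum.summable).hasSum.mul_left 2))).tsum_eq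
  have e : ∀ y, (√(heat K t x y) - √(π y)) ^ 2
      = heat K t x y + π y - 2 * geomMean (heat K t x y) (π y) := fun y => by
    rw [geomMean]
    nlinarith [Real.sq_sqrt (hp.nonneg y), Real.sq_sqrt (hπ.nonneg y)]
  simp_rw [e]
  rw [h, aff]
  ring

/-! ### Distances of product chains -/

section ProductDistance

variable {X : ℕ → Type u} {K : ∀ n, X n → X n → ℝ} {π : ∀ n, X n → ℝ} {p : ℕ → ℝ}
  {φ : ℝ → ℝ → ℝ}

theorem weightSum_pos (hp : ∀ n, 0 < p n) (n : ℕ) : 0 < weightSum p n :=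
  Finset.sum_pos (fun i _ => hp i) ⟨0, by simp⟩

theorem div_weightSum_nonneg (hp : ∀ n, 0 < p n) (n : ℕ) (i : Fin (n + 1)) :
    0 ≤ p i / weightSum p n :=
  (div_pos (hp i) (weightSum_pos hp n)).le

theorem sum_div_weightSum (hp : ∀ n, 0 < p n) (n : ℕ) :
    ∑ i : Fin (n + 1), p i / weightSum p n = 1 := by
  rw [← Finset.sum_div, Fin.sum_univ_eq_sum_range (fun i => p i)]
  exact div_self (weightSum_pos hp n).ne'

theorem isStoch_productK (hK : ∀ n, IsStoch (K n)) (hp : ∀ n, 0 < p n) (n : ℕ) :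
    IsStoch (productK K p n) :=
  isStoch_prodMat (fun i : Fin (n + 1) => hK i) (div_weightSum_nonneg hp n)
    (sum_div_weightSum hp n)

theorem isProb_productPi (hπ : ∀ n, IsProb (π n)) (n : ℕ) : IsProb (productPi π n) :=
  isProb_pi fun i : Fin (n + 1) => hπ i

theorem heat_productK (hK : ∀ n, IsStoch (K n)) (hp : ∀ n, 0 < p n) (n : ℕ) (t : ℝ)
    (x y : ∀ i : Fin (n + 1), X i) :
    heat (productK K p n) (weightSum p n * t) x y = ∏ i : Fin (n + 1), heat (K i) (p i * t) (x i) (y i) := by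
  refine (heat_prodMat (fun i : Fin (n + 1) => hK i) (div_weightSum_nonneg hp n)
    (sum_div_weightSum hp n) _ x y).trans (Finset.prod_congr rfl fun i _ => ?_)
  have h := (weightSum_pos hp n).ne'
  congr 1
  field_simp

theorem affDist_le_product (hφ : IsAffinity φ) (hK : ∀ n, IsStoch (K n))
    (hπ : ∀ n, IsProb (π n)) (hp : ∀ n, 0 < p n) {n i : ℕ} (hi : i ≤ n) {t : ℝ} (ht : 0 ≤ t) :
    affDist φ (K i) (π i) (p i * t)
      ≤ affDist φ (productK K p n) (productPi π n) (weightSum p n * t) := by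
  classical
  refine affDist_le (hπ i) fun z => ?_
  have hne : ∀ j : Fin (n + 1), Nonempty (X j) := fun j => (hπ j).nonempty
  -- Only the `i`th coordinate of the starting point matters; the others are arbitrary.
  let x : ∀ j : Fin (n + 1), X j :=
    Function.update (fun j => (hne j).some) ⟨i, Nat.lt_succ_of_le hi⟩ z
  have hx : x ⟨i, Nat.lt_succ_of_le hi⟩ = z := Function.update_self ..
  refine le_trans ?_ (le_affDist hφ (isStoch_productK hK hp n) (isProb_productPi hπ n)
    (mul_nonneg (weightSum_pos hp n).le ht) x)
  have h1 := hφ.aff_pi_le (a := fun j : Fin (n + 1) => heat (K j) (p j * t) (x j))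
    (b := fun j : Fin (n + 1) => π j)
    (fun j => ((hK j).heat (mul_nonneg (hp j).le ht)).isProb (x j)) (fun j => hπ j)
    ⟨i, Nat.lt_succ_of_le hi⟩
  rw [hx] at h1
  have e : heat (productK K p n) (weightSum p n * t) x
      = fun y => ∏ j : Fin (n + 1), heat (K j) (p j * t) (x j) (y j) :=
    funext fun y => heat_productK hK hp n t x y
  rw [e]
  exact sub_le_sub_left h1 1

theorem prod_one_sub_affDist_le (hφ : IsAffinity φ) (hK : ∀ n, IsStoch (K n))
    (hπ : ∀ n, IsProb (π n)) (hp : ∀ n, 0 < p n) (n : ℕ) {t : ℝ} (ht : 0 ≤ t) :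
    ∏ i ∈ Finset.range (n + 1), (1 - affDist φ (K i) (π i) (p i * t))
      ≤ 1 - affDist φ (productK K p n) (productPi π n) (weightSum p n * t) := by
  rw [le_sub_comm]
  refine affDist_le (isProb_productPi hπ n) fun x => sub_le_sub_left ?_ 1
  have ht' : ∀ i, 0 ≤ p i * t := fun i => mul_nonneg (hp i).le ht
  have h1 := hφ.prod_aff_le (a := fun j : Fin (n + 1) => heat (K j) (p j * t) (x j))
    (b := fun j : Fin (n + 1) => π j)
    (fun j => ((hK j).heat (ht' j)).isProb (x j)) (fun j => hπ j)
  have e : heat (productK K p n) (weightSum p n * t) x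
      = fun y => ∏ j : Fin (n + 1), heat (K j) (p j * t) (x j) (y j) :=
    funext fun y => heat_productK hK hp n t x y
  rw [e]
  refine le_trans ?_ h1
  rw [← Fin.prod_univ_eq_prod_range (fun i => 1 - affDist φ (K i) (π i) (p i * t))]
  refine Finset.prod_le_prod (fun i _ => ?_) fun i _ => ?_
  · exact sub_nonneg.2 (affDist_le_one hφ (hK i) (hπ i) (ht' i))
  · have := le_affDist hφ (hK i) (hπ i) (ht' i) (x i)
    linarith

end ProductDistance

/-! ### Growth of the scales, decay in time and mixing times -/

/-- For nondecreasing `A`, the linear part grows by at least `A 0 * (n - i)`. In the other case `A n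
* (n + 1)` differs from `A₀ * (n + 1)` by at most `M'`. Monotonicity of `B` only helps, and `C`
costs a constant. -/
theorem exists_growth_bound {A B C D : ℕ → ℝ}
    (hA : (∀ n, 0 < A n ∧ A n ≤ A (n + 1)) ∨
      ∃ A₀ : ℝ, 0 < A₀ ∧ ∃ M : ℝ, ∀ n : ℕ, ((n : ℝ) + 1) * |A n - A₀| ≤ M)
    (hB : ∀ n, B n ≤ B (n + 1)) (hC : ∃ M : ℝ, ∀ n, |C n| ≤ M)
    (hD : ∀ n : ℕ, D n = A n * ((n : ℝ) + 1) + B n + C n) :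
    ∃ c M : ℝ, 0 < c ∧ ∀ i n : ℕ, i ≤ n → c * ((n : ℝ) - i) - M ≤ D n - D i := by
  obtain ⟨M, hM⟩ := hC
  have hBm : Monotone B := monotone_nat_of_le_succ hB
  have hCC : ∀ i n, -(2 * M) ≤ C n - C i := fun i n => by
    have h1 := abs_le.1 (hM i)
    have h2 := abs_le.1 (hM n)
    linarith [h1.2, h2.1]
  rcases hA with hA | ⟨A₀, hA₀, M', hM'⟩
  · have hAm : Monotone A := monotone_nat_of_le_succ fun n => (hA n).2
    refine ⟨A 0, 2 * M, (hA 0).1, fun i n hin => ?_⟩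
    have hin' : (i : ℝ) ≤ n := Nat.cast_le.2 hin
    have h1 := mul_le_mul_of_nonneg_right (hAm hin) (by positivity : (0 : ℝ) ≤ (n : ℝ) + 1)
    have h2 := mul_le_mul_of_nonneg_right (hAm (Nat.zero_le i)) (sub_nonneg.2 hin')
    have h3 := hBm hin
    have h4 := hCC i n
    rw [hD, hD]
    linarith
  · refine ⟨A₀, 2 * M' + 2 * M, hA₀, fun i n hin => ?_⟩
    have key : ∀ n : ℕ, |(A n - A₀) * ((n : ℝ) + 1)| ≤ M' := fun n => by
      rw [abs_mul, abs_of_nonneg (by positivity : (0 : ℝ) ≤ (n : ℝ) + 1), mul_comm]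
      exact hM' n
    have h1 := abs_le.1 (key i)
    have h2 := abs_le.1 (key n)
    have h3 := hBm hin
    have h4 := hCC i n
    rw [hD, hD]
    linarith [h1.2, h2.1]

/-- Geometric decay along multiples of a time implies decay of order `1 / t`. -/
theorem exists_decay_bound {β : ℝ} (h0 : 0 < β) (h1 : β < 1) : ∃ C : ℝ, 0 < C ∧
    ∀ (d : ℝ → ℝ) (T : ℝ), 0 < T → (∀ s t, 0 ≤ s → s ≤ t → d t ≤ d s) →
      (∀ m : ℕ, d (m * (2 * T)) ≤ β ^ m) → ∀ t, 0 < t → d t ≤ C * (T / t) := by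
  have hb : 0 < 1 - β := by linarith
  refine ⟨2 / (1 - β), by positivity, fun d T hT anti hpow t ht => ?_⟩
  set m := ⌊t / (2 * T)⌋₊ with hm
  have hm1 : (m : ℝ) * (2 * T) ≤ t := by
    rw [← le_div_iff₀ (by positivity)]
    exact Nat.floor_le (by positivity)
  have hm2 : t < (m + 1) * (2 * T) := by
    rw [← div_lt_iff₀ (by positivity)]
    exact Nat.lt_floor_add_one _
  have hd : d t ≤ β ^ m := (anti _ _ (by positivity) hm1).trans (hpow m)
  -- `(m + 1) β ^ m ≤ ∑ j ≤ m, β ^ j ≤ 1 / (1 - β)`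
  have hsum : ((m : ℝ) + 1) * β ^ m ≤ (1 - β)⁻¹ := by
    rw [← tsum_geometric_of_lt_one h0.le h1]
    refine le_trans ?_ ((summable_geometric_of_lt_one h0.le h1).sum_le_tsum
      (Finset.range (m + 1)) fun i _ => pow_nonneg h0.le i)
    have : ((m : ℝ) + 1) * β ^ m = ∑ _j ∈ Finset.range (m + 1), β ^ m := by simp
    rw [this]
    exact Finset.sum_le_sum fun j hj =>
      pow_le_pow_of_le_one h0.le h1.le (Nat.lt_succ_iff.1 (Finset.mem_range.1 hj))
  refine hd.trans ?_
  have h2 : t * β ^ m ≤ (m + 1) * (2 * T) * β ^ m :=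
    mul_le_mul_of_nonneg_right hm2.le (pow_nonneg h0.le m)
  have h3 := mul_le_mul_of_nonneg_left hsum (by positivity : 0 ≤ 2 * T)
  have h4 : 2 / (1 - β) * (T / t) = 2 * T * (1 - β)⁻¹ / t := by field_simp
  rw [h4, le_div_iff₀ ht]
  linarith

section MixingTime

variable {d : ℝ → ℝ} {e p D : ℝ}

/-- `ENNReal.log` is infinite at `0` and at `∞`, so a real value forces the mixing time to be
positive and finite. -/
theorem mixingTime_eq (hp : 0 < p)
    (h : ENNReal.log (mixingTime d e / ENNReal.ofReal p) = (D : EReal)) :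
    mixingTime d e = ENNReal.ofReal (p * Real.exp D) := by
  have h1 : mixingTime d e / ENNReal.ofReal p = ENNReal.ofReal (Real.exp D) := by
    apply ENNReal.log_injective
    rw [h, ENNReal.log_ofReal_of_pos (Real.exp_pos D), Real.log_exp]
  have hp0 : ENNReal.ofReal p ≠ 0 := by simpa using hp
  rw [ENNReal.ofReal_mul hp.le, ← h1, ENNReal.mul_div_cancel hp0 ENNReal.ofReal_ne_top]

theorem lt_of_lt_mixingTime {T t : ℝ} (h : mixingTime d e = ENNReal.ofReal T) (ht : 0 ≤ t)
    (htT : t < T) : e < d t := by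
  by_contra hcon
  have h1 : mixingTime d e ≤ ENNReal.ofReal t := iInf₂_le t ⟨ht, not_lt.1 hcon⟩
  rw [h] at h1
  exact absurd ((ENNReal.ofReal_le_ofReal_iff ht).1 h1) (not_le.2 htT)

/-- The infimum need not be attained, so the bound is claimed only strictly after `T`. For this
reason the decay is later taken along multiples of `2 * T`. -/
theorem le_of_mixingTime_lt {T t : ℝ} (h : mixingTime d e = ENNReal.ofReal T) (hT : 0 ≤ T)
    (anti : ∀ s t, 0 ≤ s → s ≤ t → d t ≤ d s) (htT : T < t) : d t ≤ e := by
  have h1 : mixingTime d e < ENNReal.ofReal t := by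
    rw [h]
    exact (ENNReal.ofReal_lt_ofReal_iff (hT.trans_lt htT)).2 htT
  simp only [mixingTime, iInf_lt_iff] at h1
  obtain ⟨s, ⟨hs0, hs⟩, hst⟩ := h1
  exact (anti s t hs0 ((ENNReal.ofReal_lt_ofReal_iff (hT.trans_lt htT)).1 hst).le).trans hs

end MixingTime

/-- Cutoff only sees the limits `0` and `1`, so it passes between the Hellinger distance and its
square with the same cutoff time. -/
theorem IsCutoffTime.map {d d' : ℕ → ℝ → ℝ} {t : ℕ → ℝ} (h : IsCutoffTime d t) {ψ : ℝ → ℝ}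
    (hψ : Continuous ψ) (h0 : ψ 0 = 0) (h1 : ψ 1 = 1)
    (hd : ∀ n s, 0 ≤ s → d' n s = ψ (d n s)) : IsCutoffTime d' t := by
  refine ⟨h.1, fun a ha => ?_, fun a ha0 ha1 => ?_⟩
  · have := (hψ.tendsto 0).comp (h.2.1 a ha)
    rw [h0] at this
    refine this.congr fun n => (hd n _ ?_).symm
    exact mul_nonneg (by linarith) (h.1 n).le
  · have := (hψ.tendsto 1).comp (h.2.2 a ha0 ha1)
    rw [h1] at this
    refine this.congr fun n => (hd n _ ?_).symm
    exact mul_nonneg ha0.le (h.1 n).le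

theorem HasCutoff.map {d d' : ℕ → ℝ → ℝ} (h : HasCutoff d) {ψ : ℝ → ℝ}
    (hψ : Continuous ψ) (h0 : ψ 0 = 0) (h1 : ψ 1 = 1)
    (hd : ∀ n s, 0 ≤ s → d' n s = ψ (d n s)) : HasCutoff d' :=
  h.imp fun _ ht => ht.map hψ h0 h1 hd

/-! ### The comparison hypotheses for both distances -/

section Main

variable {X : ℕ → Type u} {K : ∀ n, X n → X n → ℝ} {π : ∀ n, X n → ℝ} {p D : ℕ → ℝ}
  {φ : ℝ → ℝ → ℝ}

theorem productFamily_affDist (hφ : IsAffinity φ) (h : ∀ n, IsStatChain (K n) (π n))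
    (hp : ∀ n, 0 < p n)
    (hD : ∃ c M : ℝ, 0 < c ∧ ∀ i n : ℕ, i ≤ n → c * ((n : ℝ) - i) - M ≤ D n - D i)
    (hdecay : ∃ β : ℝ, 0 < β ∧ β < 1 ∧ ∀ (n m : ℕ),
      affDist φ (K n) (π n) (m * (2 * (p n * Real.exp (D n)))) ≤ β ^ m)
    (hlow : ∃ a : ℝ, 0 < a ∧ ∀ n t, 0 ≤ t → t < p n * Real.exp (D n) →
      a ≤ affDist φ (K n) (π n) t)
    (hup : ∃ b : ℝ, b < 1 ∧ ∀ n t, p n * Real.exp (D n) < t → affDist φ (K n) (π n) t ≤ b) :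
    ProductFamily (fun n => affDist φ (K n) (π n))
      (fun n => affDist φ (productK K p n) (productPi π n)) p (weightSum p)
      (fun n => Real.exp (D n)) where
  p_pos := hp
  q_pos := weightSum_pos hp
  E_pos n := Real.exp_pos _
  nonneg n t ht := affDist_nonneg hφ (h n).stoch (h n).prob ht
  le_one n t ht := affDist_le_one hφ (h n).stoch (h n).prob ht
  anti n s t hs hst := affDist_anti hφ (h n) hs hst
  prod_le_one n t ht := affDist_le_one hφ (isStoch_productK (fun n => (h n).stoch) hp n)
    (isProb_productPi (fun n => (h n).prob) n) ht
  le_prod n i t ht hi :=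
    affDist_le_product hφ (fun n => (h n).stoch) (fun n => (h n).prob) hp hi ht
  prod_upper n t ht :=
    prod_one_sub_affDist_le hφ (fun n => (h n).stoch) (fun n => (h n).prob) hp n ht
  decay := by
    obtain ⟨β, hβ0, hβ1, hβ⟩ := hdecay
    obtain ⟨C, hC, hd⟩ := exists_decay_bound hβ0 hβ1
    exact ⟨C, hC, fun n t ht => hd _ _ (mul_pos (hp n) (Real.exp_pos _))
      (fun s t hs hst => affDist_anti hφ (h n) hs hst) (hβ n) t ht⟩
  growth := by
    obtain ⟨c, M, hc, hM⟩ := hD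
    refine ⟨c, Real.exp M, hc, Real.exp_pos M, fun i n hin => ?_⟩
    rw [← Real.exp_nat_mul, ← Real.exp_add, ← Real.exp_add, Nat.cast_sub hin]
    refine Real.exp_le_exp.2 ?_
    linarith [hM i n hin]
  threshold_le := hlow
  le_threshold := hup

/-- The bound `1/2` on `ε` enters through the decay ratio `2 * b < 1`. -/
theorem productFamily_min (h : ∀ n, IsStatChain (K n) (π n)) (hp : ∀ n, 0 < p n)
    (hD : ∃ c M : ℝ, 0 < c ∧ ∀ i n : ℕ, i ≤ n → c * ((n : ℝ) - i) - M ≤ D n - D i)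
    {ε : ℕ → ℝ} (hinf : ∃ a : ℝ, 0 < a ∧ ∀ n, a ≤ ε n) (hsup : ∃ b : ℝ, b < 1 / 2 ∧ ∀ n, ε n ≤ b)
    (hmix : ∀ n, ENNReal.log (mixingTime (dTV (K n) (π n)) (ε n) / ENNReal.ofReal (p n))
      = (D n : EReal)) :
    ProductFamily (fun n => affDist min (K n) (π n))
      (fun n => affDist min (productK K p n) (productPi π n)) p (weightSum p)
      (fun n => Real.exp (D n)) := by
  obtain ⟨a, ha, hεa⟩ := hinf
  obtain ⟨b, hb, hεb⟩ := hsup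
  have hb0 : 0 < b := ha.trans_le ((hεa 0).trans (hεb 0))
  have hT : ∀ n, 0 < p n * Real.exp (D n) := fun n => mul_pos (hp n) (Real.exp_pos _)
  have heq : ∀ n t, 0 ≤ t → dTV (K n) (π n) t = affDist min (K n) (π n) t :=
    fun n t ht => dTV_eq_affDist (h n).stoch (h n).prob ht
  have hup : ∀ n t, p n * Real.exp (D n) < t → affDist min (K n) (π n) t ≤ b := by
    intro n t ht
    rw [← heq n t ((hT n).trans ht).le]
    refine (le_of_mixingTime_lt (mixingTime_eq (hp n) (hmix n)) (hT n).le
      (fun s t hs hst => ?_) ht).trans (hεb n)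
    rw [heq n s hs, heq n t (hs.trans hst)]
    exact affDist_anti isAffinity_min (h n) hs hst
  refine productFamily_affDist isAffinity_min h hp hD ⟨2 * b, by linarith, by linarith, ?_⟩
    ⟨a, ha, ?_⟩ ⟨b, by linarith, hup⟩
  · intro n m
    have h2T : 0 ≤ 2 * (p n * Real.exp (D n)) := by have := hT n; linarith
    refine (affDist_min_mul_le (h n) h2T m).trans (pow_le_pow_left₀ ?_ ?_ m)
    · have := affDist_nonneg isAffinity_min (h n).stoch (h n).prob h2T
      linarith
    · have := hup n (2 * (p n * Real.exp (D n))) (by have := hT n; linarith)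
      linarith
  · intro n t ht htT
    rw [← heq n t ht]
    exact (hεa n).trans (lt_of_lt_mixingTime (mixingTime_eq (hp n) (hmix n)) ht htT).le

theorem productFamily_geomMean (h : ∀ n, IsStatChain (K n) (π n)) (hp : ∀ n, 0 < p n)
    (hD : ∃ c M : ℝ, 0 < c ∧ ∀ i n : ℕ, i ≤ n → c * ((n : ℝ) - i) - M ≤ D n - D i)
    {ε : ℕ → ℝ} (hinf : ∃ a : ℝ, 0 < a ∧ ∀ n, a ≤ ε n) (hsup : ∃ b : ℝ, b < 1 / 4 ∧ ∀ n, ε n ≤ b)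
    (hmix : ∀ n, ENNReal.log (mixingTime (dH (K n) (π n)) (ε n) / ENNReal.ofReal (p n))
      = (D n : EReal)) :
    ProductFamily (fun n => affDist geomMean (K n) (π n))
      (fun n => affDist geomMean (productK K p n) (productPi π n)) p (weightSum p)
      (fun n => Real.exp (D n)) := by
  obtain ⟨a, ha, hεa⟩ := hinf
  obtain ⟨b, hb, hεb⟩ := hsup
  have hb0 : 0 < b := ha.trans_le ((hεa 0).trans (hεb 0))
  have hT : ∀ n, 0 < p n * Real.exp (D n) := fun n => mul_pos (hp n) (Real.exp_pos _)
  have heq : ∀ n t, 0 ≤ t → dH (K n) (π n) t = √(affDist geomMean (K n) (π n) t) :=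
    fun n t ht => dH_eq_sqrt_affDist (h n).stoch (h n).prob ht
  have hup : ∀ n t, p n * Real.exp (D n) < t → affDist geomMean (K n) (π n) t ≤ 1 / 16 := by
    intro n t ht
    have h1 : dH (K n) (π n) t ≤ b := by
      refine (le_of_mixingTime_lt (mixingTime_eq (hp n) (hmix n)) (hT n).le
        (fun s t hs hst => ?_) ht).trans (hεb n)
      rw [heq n s hs, heq n t (hs.trans hst)]
      exact Real.sqrt_le_sqrt (affDist_anti isAffinity_geomMean (h n) hs hst)
    rw [heq n t ((hT n).trans ht).le, Real.sqrt_le_left hb0.le] at h1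
    nlinarith
  -- After the mixing time the squared distance is at most `1/16`, so the total variation is at most
  -- `2/16 + 1/4 = 3/8`, and twice this is the ratio `3/4`.
  refine productFamily_affDist isAffinity_geomMean h hp hD ⟨3 / 4, by norm_num, by norm_num, ?_⟩
    ⟨a ^ 2, by positivity, ?_⟩ ⟨1 / 16, by norm_num, hup⟩
  · intro n m
    have h2T : 0 ≤ 2 * (p n * Real.exp (D n)) := by have := hT n; linarith
    refine (affDist_geomMean_le (h n) (mul_nonneg (Nat.cast_nonneg m) h2T)).trans
      ((affDist_min_mul_le (h n) h2T m).trans (pow_le_pow_left₀ ?_ ?_ m))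
    · have := affDist_nonneg isAffinity_min (h n).stoch (h n).prob h2T
      linarith
    · have h1 := hup n (2 * (p n * Real.exp (D n))) (by have := hT n; linarith)
      have h2 := affDist_min_le (h n) h2T
      linarith
  · intro n t ht htT
    have h1 := (hεa n).trans
      (lt_of_lt_mixingTime (mixingTime_eq (hp n) (hmix n)) ht htT).le
    rw [heq n t ht] at h1
    exact (Real.le_sqrt' ha).1 h1

end Main

end

end ProductChain

/-! ### The theorem -/

open ProductChain in
/-- Chains are indexed from `0`: the chain, weight and constants with index `n` here are those
with index `n + 1` in the usual enumeration `1, 2, …`. -/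
theorem theorem1p2 {X : ℕ → Type*} [∀ n, Countable (X n)]
    (K : ∀ n, X n → X n → ℝ) (π : ∀ n, X n → ℝ)
    (hchain : ∀ n, ProductChain.IsIrreducibleChain (K n) (π n))
    (p : ℕ → ℝ) (hp : ∀ n, 0 < p n)
    (ε A B C : ℕ → ℝ)
    (hε_inf : ∃ a : ℝ, 0 < a ∧ ∀ n, a ≤ ε n)
    (hA : (∀ n, 0 < A n ∧ A n ≤ A (n + 1)) ∨
      ∃ A₀ : ℝ, 0 < A₀ ∧ ∃ M : ℝ, ∀ n : ℕ, ((n : ℝ) + 1) * |A n - A₀| ≤ M)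
    (hB : ∀ n, B n ≤ B (n + 1))
    (hC : ∃ M : ℝ, ∀ n, |C n| ≤ M)
    (D : ℕ → ℝ) (hD : ∀ n : ℕ, D n = A n * ((n : ℝ) + 1) + B n + C n)
    (hD_mono : ∃ N : ℕ, ∀ n, N ≤ n → D n ≤ D (n + 1)) :
    -- total variation
    ((∃ b : ℝ, b < 1 / 2 ∧ ∀ n, ε n ≤ b) →
      (∀ n, ENNReal.log (ProductChain.mixingTime (ProductChain.dTV (K n) (π n)) (ε n) /
        ENNReal.ofReal (p n)) = (D n : EReal)) →
      (∀ t : ℕ → ℝ, ProductChain.IsCutoffTime (fun n => ProductChain.dTV (K n) (π n)) t →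
        ProductChain.IsCutoffTime
          (fun n => ProductChain.dTV (ProductChain.productK K p n) (ProductChain.productPi π n))
          (fun n => ProductChain.weightSum p n * t n / p n)) ∧
      ((∀ ξ : ℕ → ℕ, StrictMono ξ →
          ¬ ProductChain.HasCutoff (fun n => ProductChain.dTV (K (ξ n)) (π (ξ n)))) →
        ¬ ProductChain.HasCutoff
          (fun n => ProductChain.dTV (ProductChain.productK K p n)
            (ProductChain.productPi π n)))) ∧
    -- Hellinger distance
    ((∃ b : ℝ, b < 1 / 4 ∧ ∀ n, ε n ≤ b) →
      (∀ n, ENNReal.log (ProductChain.mixingTime (ProductChain.dH (K n) (π n)) (ε n) /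
        ENNReal.ofReal (p n)) = (D n : EReal)) →
      (∀ t : ℕ → ℝ, ProductChain.IsCutoffTime (fun n => ProductChain.dH (K n) (π n)) t →
        ProductChain.IsCutoffTime
          (fun n => ProductChain.dH (ProductChain.productK K p n) (ProductChain.productPi π n))
          (fun n => ProductChain.weightSum p n * t n / p n)) ∧
      ((∀ ξ : ℕ → ℕ, StrictMono ξ →
          ¬ ProductChain.HasCutoff (fun n => ProductChain.dH (K (ξ n)) (π (ξ n)))) →
        ¬ ProductChain.HasCutoff
          (fun n => ProductChain.dH (ProductChain.productK K p n)
            (ProductChain.productPi π n)))) := by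
  have hS : ∀ n, IsStatChain (K n) (π n) := fun n => (hchain n).isStatChain
  have hst := fun n => (hS n).stoch
  have hpr := fun n => (hS n).prob
  have hP := isStoch_productK hst hp
  have hPpr := isProb_productPi hpr
  have hgrow := exists_growth_bound hA hB hC hD
  have hmono : ∃ N : ℕ, ∀ n, N ≤ n → Real.exp (D n) ≤ Real.exp (D (n + 1)) :=
    hD_mono.imp fun N hN n hn => Real.exp_le_exp.2 (hN n hn)
  refine ⟨fun hsup hmix => ?_, fun hsup hmix => ?_⟩
  · have fam := productFamily_min hS hp hgrow hε_inf hsup hmix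
    refine ⟨fun t ht => ?_, fun hno hcut => ?_⟩
    · have h1 := ht.map continuous_id rfl rfl
        fun n s hs => (dTV_eq_affDist (hst n) (hpr n) hs).symm
      exact (fam.isCutoffTime_prod hmono h1).map continuous_id rfl rfl
        fun n s hs => dTV_eq_affDist (hP n) (hPpr n) hs
    · have h1 := hcut.map continuous_id rfl rfl
        fun n s hs => (dTV_eq_affDist (hP n) (hPpr n) hs).symm
      obtain ⟨ξ, hξ, h2⟩ := fam.exists_subfamily_cutoff h1
      exact hno ξ hξ (h2.map continuous_id rfl rfl
        fun n s hs => dTV_eq_affDist (hst (ξ n)) (hpr (ξ n)) hs)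
  · have fam := productFamily_geomMean hS hp hgrow hε_inf hsup hmix
    -- The comparison runs on the squared Hellinger distance, since it is the square that is one
    -- minus an affinity.
    have sq : ∀ {Y : Type _} {k : Y → Y → ℝ} {ρ : Y → ℝ}, IsStoch k → IsProb ρ →
        ∀ s : ℝ, 0 ≤ s → affDist geomMean k ρ s = dH k ρ s ^ 2 := fun hk hρ s hs => by
      rw [dH_eq_sqrt_affDist hk hρ hs,
        Real.sq_sqrt (affDist_nonneg isAffinity_geomMean hk hρ hs)]
    refine ⟨fun t ht => ?_, fun hno hcut => ?_⟩
    · have h1 := ht.map (continuous_pow 2) (by norm_num) (by norm_num)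
        fun n s hs => sq (hst n) (hpr n) s hs
      exact (fam.isCutoffTime_prod hmono h1).map Real.continuous_sqrt Real.sqrt_zero
        Real.sqrt_one fun n s hs => dH_eq_sqrt_affDist (hP n) (hPpr n) hs
    · have h1 := hcut.map (continuous_pow 2) (by norm_num) (by norm_num)
        fun n s hs => sq (hP n) (hPpr n) s hs
      obtain ⟨ξ, hξ, h2⟩ := fam.exists_subfamily_cutoff h1
      exact hno ξ hξ (h2.map Real.continuous_sqrt Real.sqrt_zero Real.sqrt_one
        fun n s hs => dH_eq_sqrt_affDist (hst (ξ n)) (hpr (ξ n)) hs)
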